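/- Let $m\ge 1$, $G=\mathrm{SL}(m+1,\mathbb{R})$, and for $v\in\mathbb{R}^m$ (a row vector) and $t>0$ put $$u_v=\begin{bmatrix} I_m & 0\\ v & 1\end{bmatrix},\qquad a_t=\begin{bmatrix} t^{-1/m}I_m & 0\\ 0 & t\end{bmatrix}.$$ Let $\mathcal V$ be a finite-dimensional real normed space carrying a continuous linear representation of $G$, write $\mathcal V=\mathcal V_0\oplus\mathcal V_1$, where $\mathcal V_0$ is the space of $G$-fixed vectors and $\mathcal V_1$ is its $G$-invariant complement, and let $\Pi:\mathcal V\to\mathcal V_1$ be the projection with kernel $\mathcal V_0$. Fix $r>0$, $g_0\in G$, a bounded set $K\subset\mathbb{R}^m$ and $\chi\in(0,1)$. Then for every $\nu>0$ there exists $t_0>0$ such that for all $0<t<t_0$, all $\xi\in K$ and all $\mathbf x\in\mathcal V$ with $\|\Pi(\mathbf x)\|\ge r$, $$\sup_{v\in B\left(t^{(1-\chi)/m}\right)+\xi}\left\|a_t^{-1}u_v^{-1}g_0\cdot\mathbf x\right\|>\nu,$$ where $B(\beta)$ is the Euclidean ball of radius $\beta$ in $\mathbb{R}^m$ centered at the origin.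 -/

import Mathlib

open Matrix

noncomputable section

/-- The `(m+1) × (m+1)` matrix with blocks `A` (size `m × m`), `0`, the row `v`, and the scalar `d`:
its first `m` rows are `[A 0]` and its last row is `[v d]`. -/
def lowerBlock (m : ℕ) (A : Matrix (Fin m) (Fin m) ℝ) (v : Fin m → ℝ) (d : ℝ) :
    Matrix (Fin (m + 1)) (Fin (m + 1)) ℝ :=
  Matrix.reindex finSumFinEquiv finSumFinEquiv
    (Matrix.fromBlocks A 0 (Matrix.of fun (_ : Fin 1) j => v j) (Matrix.of fun _ _ => d))

theorem det_lowerBlock (m : ℕ) (A : Matrix (Fin m) (Fin m) ℝ) (v : Fin m → ℝ) (d : ℝ) :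
    (lowerBlock m A v d).det = A.det * d := by
  simp [lowerBlock, Matrix.det_fromBlocks_zero₁₂]

/-- The unipotent element `u_v = [[I_m, 0], [v, 1]]` of `SL(m+1, ℝ)`. -/
def uElt (m : ℕ) (v : EuclideanSpace ℝ (Fin m)) : SpecialLinearGroup (Fin (m + 1)) ℝ :=
  ⟨lowerBlock m 1 (fun j => v j) 1, by simp [det_lowerBlock]⟩

theorem det_aMatrix (m : ℕ) (hm : 1 ≤ m) (t : ℝ) (ht : 0 < t) :
    (lowerBlock m ((t ^ (-(1 : ℝ) / m)) • (1 : Matrix (Fin m) (Fin m) ℝ)) 0 t).det = 1 := by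
  have hm' : (m : ℝ) ≠ 0 := by exact_mod_cast (by omega : m ≠ 0)
  rw [det_lowerBlock, Matrix.det_smul, Matrix.det_one, mul_one, Fintype.card_fin,
    ← Real.rpow_natCast, ← Real.rpow_mul ht.le, div_mul_cancel₀ _ hm', Real.rpow_neg_one,
    inv_mul_cancel₀ ht.ne']

/-- The diagonal element `a_t = [[t^(-1/m) I_m, 0], [0, t]]` of `SL(m+1, ℝ)`, for `t > 0`. -/
def aElt (m : ℕ) (hm : 1 ≤ m) (t : ℝ) (ht : 0 < t) : SpecialLinearGroup (Fin (m + 1)) ℝ :=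
  ⟨lowerBlock m ((t ^ (-(1 : ℝ) / m)) • (1 : Matrix (Fin m) (Fin m) ℝ)) 0 t,
    det_aMatrix m hm t ht⟩

end

/-! ### Representations of an `sl₂`-triple in finite dimension -/

section SlTwo

variable {k V : Type*} [Field k] [AddCommGroup V] [Module k V]

/-! Put `s = -log t`. Then `a_t⁻¹` acts as `exp (s D)`, where `D` is the average of the coroots `h
i`, and a push of size `t ^ ((1 - χ) / m)` along the `j`-th axis acts as `exp (β σ • e j)` with `β =
exp (-(1 - χ) s / m)` and `|σ| < 1`. Since `e j` is nilpotent, the pushed and flowed vector is a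
polynomial in `σ` whose `k`-th coefficient is `β ^ k / k! • exp (s D) (e j ^ k y)`. If it stays
bounded, so does every coefficient, and the part of `e j ^ k y` in the `D`-eigenvalues above `k (1 -
χ) / m` must be tiny for large `s`.

So the point is linear algebra (`IsSlFamily.eq_zero_of_forall_pow_mem`): no nonzero `y` in `V₁` has
all these parts zero. Otherwise there is a simultaneous eigenvector of the `h i`, with integer
weights `z i` and `D`-eigenvalue `lam`, their mean. Each `e j` raises the `D`-eigenvalue by `1 + 1 /
m`. For `z j` minimal and negative, `sl₂` theory gives `e j ^ n y ≠ 0` for `n = -z j ≤ -lam + 2 *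
(lam - z j)`, while its `D`-eigenvalue, at least `n / m`, exceeds the permitted `n (1 - χ) / m`. If
no weight is negative, all vanish, `y` is killed by every root vector of the last row and column,
and these generate the group; hence `y` is fixed, so zero.

Injectivity in finite dimension makes this quantitative (`IsSlFamily.eventually_norm_le`). The Lie
algebra action is obtained by differentiating one-parameter subgroups. -/

theorem lie_pow_of_lie_eq {A : Type*} [Ring A] [Algebra k A] {h e : A} {c : k}
    (he : h * e = e * h + c • e) (n : ℕ) : h * e ^ n = e ^ n * h + (n * c) • e ^ n := by
  induction n with
  | zero => simp
  | succ n ih =>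
    rw [pow_succ, ← mul_assoc, ih, add_mul, mul_assoc, he, mul_add, smul_mul_assoc]
    simp only [mul_smul_comm, ← mul_assoc, Nat.cast_add, Nat.cast_one, add_mul, one_mul, add_smul]
    abel

/-- `T = h - μ` is bijective on the sum `Q` of the other generalized eigenspaces. Writing `T v = a +
T u` with `u ∈ Q` and `a` in the `μ`-part, a power of `T` kills `v - u`. -/
theorem mem_iSup_maxGenEigenspace_of_sub_apply_mem [FiniteDimensional k V] {h : Module.End k V}
    (μ : k) {v : V} (hv : (h - μ • (1 : Module.End k V)) v ∈ ⨆ ν, h.maxGenEigenspace ν) :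
    v ∈ ⨆ ν, h.maxGenEigenspace ν := by
  set T : Module.End k V := h - μ • 1 with hT
  have hcomm : Commute h T := (Commute.refl h).sub_right ((Commute.one_right h).smul_right μ)
  set Q : Submodule k V := ⨆ ν, ⨆ (_ : ν ≠ μ), h.maxGenEigenspace ν with hQ
  have hTQ : ∀ x ∈ Q, T x ∈ Q := by
    suffices Q ≤ Q.comap T from this
    refine iSup₂_le fun ν hν x hx => ?_
    exact (le_iSup₂_of_le (f := fun ν (_ : ν ≠ μ) => h.maxGenEigenspace ν) ν hν le_rfl)
      (Module.End.mapsTo_maxGenEigenspace_of_comm hcomm ν hx)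
  have hdisj : Disjoint (h.maxGenEigenspace μ) Q := (h.independent_maxGenEigenspace) μ
  have hinj : Function.Injective (T.restrict hTQ) := by
    rw [injective_iff_map_eq_zero]
    intro x hx
    have hx' : T x = 0 := congrArg Subtype.val hx
    have : (x : V) ∈ h.maxGenEigenspace μ :=
      (Module.End.mem_maxGenEigenspace _ _ _).2 ⟨1, by rw [pow_one]; exact hx'⟩
    exact Subtype.ext (Submodule.disjoint_def.1 hdisj _ this x.2)
  have hsurj := LinearMap.injective_iff_surjective.1 hinj
  have hle : (⨆ ν, h.maxGenEigenspace ν) ≤ h.maxGenEigenspace μ ⊔ Q := by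
    refine iSup_le fun ν => ?_
    by_cases hν : ν = μ
    · exact hν ▸ le_sup_left
    · exact le_sup_of_le_right
        (le_iSup₂_of_le (f := fun ν (_ : ν ≠ μ) => h.maxGenEigenspace ν) ν hν le_rfl)
  obtain ⟨a, ha, b, hb, hab⟩ := Submodule.mem_sup.1 (hle hv)
  obtain ⟨u, hu⟩ := hsurj ⟨b, hb⟩
  have hu' : T u = b := congrArg Subtype.val hu
  have hvu : v - u ∈ h.maxGenEigenspace μ := by
    obtain ⟨n, hn⟩ := (Module.End.mem_maxGenEigenspace _ _ _).1 ha
    refine (Module.End.mem_maxGenEigenspace _ _ _).2 ⟨n + 1, ?_⟩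
    have hTa : T (v - u) = a := by rw [map_sub, hu', ← hab, add_sub_cancel_right]
    rw [pow_succ, Module.End.mul_apply, ← hT, hTa]
    exact hn
  have := add_mem (Submodule.mem_iSup_of_mem μ hvu)
    ((iSup₂_le fun ν _ => le_iSup (fun ν => h.maxGenEigenspace ν) ν :
      Q ≤ ⨆ ν, h.maxGenEigenspace ν) u.2)
  simpa using this

theorem mem_iSup_maxGenEigenspace_of_prod_apply_mem [FiniteDimensional k V] {h : Module.End k V}
    (l : List k) {v : V}
    (hv : (l.map fun i => h - i • (1 : Module.End k V)).prod v ∈ ⨆ ν, h.maxGenEigenspace ν) :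
    v ∈ ⨆ ν, h.maxGenEigenspace ν := by
  induction l with
  | nil => simpa using hv
  | cons a l ih =>
    rw [List.map_cons, List.prod_cons, Module.End.mul_apply] at hv
    exact ih (mem_iSup_maxGenEigenspace_of_sub_apply_mem a hv)

theorem prod_sub_mul_of_mul_eq {h T : Module.End k V} {c : k} (hT : h * T = T * h + c • T)
    (l : List k) :
    (l.map fun i => h - i • (1 : Module.End k V)).prod * T =
      T * ((l.map fun i => i - c).map fun i => h - i • (1 : Module.End k V)).prod := by
  induction l with
  | nil => simp
  | cons a l ih =>
    simp only [List.map_cons, List.prod_cons] at ih ⊢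
    rw [mul_assoc, ih, ← mul_assoc, ← mul_assoc, sub_mul, hT]
    congr 1
    simp only [mul_sub, smul_mul_assoc, one_mul, mul_smul_comm, mul_one]
    module

variable [CharZero k]

/-- Nonzero powers `e ^ n` would be eigenvectors of the commutator with `h` for the infinitely many
eigenvalues `n * c`. -/
theorem isNilpotent_of_lie_eq_smul {A : Type*} [Ring A] [Algebra k A] [FiniteDimensional k A]
    {h e : A} {c : k} (hc : c ≠ 0) (he : h * e = e * h + c • e) : IsNilpotent e := by
  by_contra hn
  have hne : ∀ n : ℕ, e ^ n ≠ 0 := fun n h0 => hn ⟨n, h0⟩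
  let D : Module.End k A := LinearMap.mulLeft k h - LinearMap.mulRight k h
  have hev : ∀ n : ℕ, D.HasEigenvalue (n * c) := fun n =>
    Module.End.hasEigenvalue_of_hasEigenvector (x := e ^ n)
      ⟨Module.End.mem_eigenspace_iff.2 (by simp [D, lie_pow_of_lie_eq he n]), hne n⟩
  have hfin : Set.Finite {μ | D.HasEigenvalue μ} := Module.End.finite_hasEigenvalue D
  refine Set.infinite_range_of_injective (f := fun n : ℕ => (n : k) * c) ?_
    (hfin.subset (by rintro _ ⟨n, rfl⟩; exact hev n))
  intro a b hab
  exact_mod_cast mul_right_cancel₀ hc hab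

variable {e f h : Module.End k V}

theorem sl2_e_mul_f_pow (hef : e * f = f * e + h) (hhf : h * f = f * h + (-2 : k) • f) (n : ℕ) :
    e * f ^ (n + 1) = f ^ (n + 1) * e + ((n : k) + 1) • (f ^ n * (h - (n : k) • 1)) := by
  induction n with
  | zero => simp [hef]
  | succ n ih =>
    rw [pow_succ, ← mul_assoc, ih, add_mul, mul_assoc _ e f, hef, smul_mul_assoc, mul_assoc, sub_mul,
      hhf]
    have h1 : f ^ n * (f * h) = f ^ (n + 1) * h := by rw [pow_succ, mul_assoc]
    have h2 : f ^ n * f = f ^ (n + 1) := (pow_succ _ _).symm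
    simp only [mul_add, mul_sub, smul_mul_assoc, one_mul, mul_smul_comm, h1, h2, ← mul_assoc, mul_one]
    push_cast
    module

theorem sl2_f_mul_e_pow (hef : e * f = f * e + h) (hhe : h * e = e * h + (2 : k) • e) (n : ℕ) :
    f * e ^ (n + 1) = e ^ (n + 1) * f - ((n : k) + 1) • (e ^ n * (h + (n : k) • 1)) := by
  have := sl2_e_mul_f_pow (k := k) (e := f) (f := e) (h := -h) (by rw [hef]; abel)
    (by rw [neg_mul, hhe, mul_neg, neg_add, neg_smul]) n
  rw [this, show -h - (n : k) • (1 : Module.End k V) = -(h + (n : k) • 1) by abel, mul_neg, smul_neg,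
    sub_eq_add_neg]

/-- On the kernel of `e`, the operator `e ^ n * f ^ n` is a split polynomial in `h`. -/
theorem sl2_e_pow_mul_f_pow_apply (hef : e * f = f * e + h)
    (hhe : h * e = e * h + (2 : k) • e) (hhf : h * f = f * h + (-2 : k) • f) (n : ℕ) (v : V)
    (hv : e v = 0) :
    (e ^ n * f ^ n) v =
      (n.factorial : k) •
        ((List.range n).map fun i : ℕ => h - (i : k) • (1 : Module.End k V)).prod v := by
  induction n generalizing v with
  | zero => simp
  | succ n ih =>
    have hw : e ((h - (n : k) • (1 : Module.End k V)) v) = 0 := by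
      have := congrArg (fun T : Module.End k V => T v) hhe
      simp [hv] at this
      simp [hv, ← this]
    have := congrArg (fun T : Module.End k V => T v) (sl2_e_mul_f_pow hef hhf n)
    simp only [Module.End.mul_apply, LinearMap.add_apply, hv, map_zero, zero_add,
      LinearMap.smul_apply] at this
    rw [Module.End.mul_apply, pow_succ, Module.End.mul_apply, this, map_smul,
      ← Module.End.mul_apply, ih _ hw, List.range_succ, List.map_append, List.prod_append,
      Nat.factorial_succ]
    simp only [List.map_cons, List.map_nil, List.prod_cons, List.prod_nil, mul_one,
      Module.End.mul_apply, smul_smul]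
    push_cast
    rw [mul_comm]

variable [FiniteDimensional k V]

/-- With `f ^ M = 0`, a split polynomial in `h` kills `ker e`. For `e ^ (q + 1) v = 0`, moving that
polynomial past `e ^ q` shifts its roots and gives a vector killed by `e ^ q`; induction on `q`
applies. -/
theorem sl2_iSup_maxGenEigenspace_eq_top (hef : e * f = f * e + h)
    (hhe : h * e = e * h + (2 : k) • e) (hhf : h * f = f * h + (-2 : k) • f) :
    ⨆ μ, h.maxGenEigenspace μ = ⊤ := by
  obtain ⟨N, hN⟩ := isNilpotent_of_lie_eq_smul (by norm_num) hhe
  obtain ⟨M, hM⟩ := isNilpotent_of_lie_eq_smul (by norm_num) hhf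
  suffices ∀ (q : ℕ) (v : V), (e ^ q) v = 0 → v ∈ ⨆ μ, h.maxGenEigenspace μ from
    eq_top_iff.2 fun v _ => this N v (by simp [hN])
  intro q
  induction q with
  | zero => intro v hv; rw [show v = 0 by simpa using hv]; exact zero_mem _
  | succ q ih =>
    intro v hv
    rw [pow_succ', Module.End.mul_apply] at hv
    have h1 := sl2_e_pow_mul_f_pow_apply hef hhe hhf M _ hv
    rw [hM, mul_zero, LinearMap.zero_apply, eq_comm, smul_eq_zero_iff_right
      (by exact_mod_cast M.factorial_ne_zero), ← Module.End.mul_apply] at h1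
    rw [show ((List.range M).map fun i : ℕ => h - (i : k) • (1 : Module.End k V)) =
      ((List.range M).map fun i : ℕ => (i : k)).map fun i => h - i • (1 : Module.End k V) by
        rw [List.map_map]; rfl,
      prod_sub_mul_of_mul_eq (lie_pow_of_lie_eq hhe q)] at h1
    exact mem_iSup_maxGenEigenspace_of_prod_apply_mem _ (ih _ h1)

/-- A lowering-raising argument: `e ^ q` is injective on the `-n` eigenspace of `h` if `q ≤ n`. -/
theorem sl2_pow_apply_ne_zero (hef : e * f = f * e + h)
    (hhe : h * e = e * h + (2 : k) • e) (hhf : h * f = f * h + (-2 : k) • f)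
    {y : V} (hy : y ≠ 0) {n q : ℕ} (hq : q ≤ n) (hhy : h y = -(n : k) • y) : (e ^ q) y ≠ 0 := by
  obtain ⟨M, hM⟩ := isNilpotent_of_lie_eq_smul (by norm_num) hhf
  -- If `e ^ (p + 1)` is the first power killing `y`, then `p < n` makes the coefficient in `key`
  -- nonzero, so `f y ≠ 0`. It has weight `-(n + 2)` and is killed by `e ^ (p + 2)`, so the argument
  -- repeats and contradicts nilpotency of `f`.
  suffices ∀ (N : ℕ) (y : V) (n q : ℕ), y ≠ 0 → q ≤ n → h y = -(n : k) • y → (e ^ q) y = 0 →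
      (f ^ N) y ≠ 0 from fun h0 => this M y n q hy hq hhy h0 (by simp [hM])
  clear hy hq hhy y n q
  intro N
  induction N with
  | zero => intro y n q hy _ _ _; simpa using hy
  | succ N ih =>
    intro y n q hy hq hhy h0
    classical
    have hex : ∃ q, (e ^ q) y = 0 := ⟨q, h0⟩
    obtain ⟨p, hp⟩ : ∃ p, Nat.find hex = p + 1 := by
      refine Nat.exists_eq_succ_of_ne_zero fun hz => hy ?_
      simpa [hz] using Nat.find_spec hex
    have hp0 : (e ^ (p + 1)) y = 0 := hp ▸ Nat.find_spec hex
    have hp1 : (e ^ p) y ≠ 0 := Nat.find_min hex (by omega)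
    have hpn : p + 1 ≤ n := (hp ▸ Nat.find_min' hex h0).trans hq
    have key : (e ^ (p + 1)) (f y) = -((((p : k) + 1) * ((n : k) - p))) • (e ^ p) y := by
      have := congrArg (fun T : Module.End k V => T y) (sl2_f_mul_e_pow hef hhe p)
      simp only [Module.End.mul_apply, hp0, map_zero, LinearMap.sub_apply, LinearMap.smul_apply,
        LinearMap.add_apply, hhy, Module.End.one_apply, ← add_smul, map_smul, smul_smul] at this
      rw [eq_comm, sub_eq_zero] at this
      rw [this]
      congr 1
      ring
    have hne : -((((p : k) + 1) * ((n : k) - p))) ≠ 0 := by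
      refine neg_ne_zero.2 (mul_ne_zero (by exact_mod_cast p.succ_ne_zero) (sub_ne_zero.2 ?_))
      exact_mod_cast (by omega : n ≠ p)
    have hfy : f y ≠ 0 := fun h1 => by
      rw [h1, map_zero, eq_comm, smul_eq_zero] at key
      exact key.elim hne hp1
    rw [pow_succ, Module.End.mul_apply]
    refine ih (f y) (n + 2) (p + 2) hfy (by omega) ?_ ?_
    · have := congrArg (fun T : Module.End k V => T y) hhf
      simp only [Module.End.mul_apply, LinearMap.add_apply, LinearMap.smul_apply, hhy,
        map_smul] at this
      rw [this, ← add_smul]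
      congr 1
      push_cast
      ring
    · rw [pow_succ', Module.End.mul_apply, key, map_smul, ← Module.End.mul_apply, ← pow_succ', hp0,
        smul_zero]

theorem sl2_lower_eq_zero (hef : e * f = f * e + h)
    (hhe : h * e = e * h + (2 : k) • e) (hhf : h * f = f * h + (-2 : k) • f)
    {y : V} (hey : e y = 0) (hhy : h y = 0) : f y = 0 := by
  by_contra hfy
  have h1 := congrArg (fun T : Module.End k V => T y) hhf
  have h2 := congrArg (fun T : Module.End k V => T y) hef
  simp only [Module.End.mul_apply, LinearMap.add_apply, LinearMap.smul_apply, hhy, hey, map_zero,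
    zero_add] at h1 h2
  exact sl2_pow_apply_ne_zero hef hhe hhf hfy (n := 2) (q := 1) (by omega) (by simpa using h1)
    (by simpa using h2)

/-- The last nonzero `e ^ p y` lies in `ker e` and has weight `c + 2 p`. It is killed by the product
of `h - i` over `i < M`, so `c + 2 p` is one of these `i`. -/
theorem sl2_eigenvalue_int (hef : e * f = f * e + h)
    (hhe : h * e = e * h + (2 : k) • e) (hhf : h * f = f * h + (-2 : k) • f)
    {y : V} (hy : y ≠ 0) {c : k} (hhy : h y = c • y) : ∃ z : ℤ, c = z := by
  obtain ⟨N, hN⟩ := isNilpotent_of_lie_eq_smul (by norm_num) hhe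
  obtain ⟨M, hM⟩ := isNilpotent_of_lie_eq_smul (by norm_num) hhf
  classical
  have hex : ∃ q, (e ^ q) y = 0 := ⟨N, by simp [hN]⟩
  obtain ⟨p, hp⟩ : ∃ p, Nat.find hex = p + 1 := by
    refine Nat.exists_eq_succ_of_ne_zero fun hz => hy ?_
    simpa [hz] using Nat.find_spec hex
  have hp0 : e ((e ^ p) y) = 0 := by
    rw [← Module.End.mul_apply, ← pow_succ']; exact hp ▸ Nat.find_spec hex
  have hp1 : (e ^ p) y ≠ 0 := Nat.find_min hex (by omega)
  have hw : h ((e ^ p) y) = (c + p * 2) • (e ^ p) y := by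
    have := congrArg (fun T : Module.End k V => T y) (lie_pow_of_lie_eq hhe p)
    simp only [Module.End.mul_apply, LinearMap.add_apply, LinearMap.smul_apply, hhy, map_smul,
      ← add_smul] at this
    exact this
  have h1 := sl2_e_pow_mul_f_pow_apply hef hhe hhf M _ hp0
  have hprod : ∀ l : List k, (l.map fun i => h - i • (1 : Module.End k V)).prod ((e ^ p) y) =
      (l.map fun i => c + p * 2 - i).prod • (e ^ p) y := by
    intro l
    induction l with
    | nil => simp
    | cons a l ih =>
      simp only [List.map_cons, List.prod_cons, Module.End.mul_apply, ih, map_smul,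
        LinearMap.sub_apply, hw, LinearMap.smul_apply, Module.End.one_apply, ← sub_smul, smul_smul]
      rw [mul_comm]
  rw [hM, mul_zero, LinearMap.zero_apply, eq_comm, smul_eq_zero_iff_right
    (by exact_mod_cast M.factorial_ne_zero),
    show ((List.range M).map fun i : ℕ => h - (i : k) • (1 : Module.End k V)) =
      ((List.range M).map fun i : ℕ => (i : k)).map fun i => h - i • (1 : Module.End k V) by
        rw [List.map_map]; rfl, hprod, smul_eq_zero_iff_left hp1, List.prod_eq_zero_iff] at h1
  simp only [List.map_map, List.mem_map, Function.comp_apply] at h1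
  obtain ⟨j, _, hj⟩ := h1
  exact ⟨j - p * 2, by push_cast; linear_combination hj⟩

end SlTwo

/-! ### Generalized eigenspaces of commuting operators -/

section Weights

open Module.End

variable {k V : Type*} [Field k] [AddCommGroup V] [Module k V]

theorem iInf_maxGenEigenspace_le_sum {ι : Type*} (s : Finset ι) (h : ι → Module.End k V)
    (hc : Pairwise fun i j => Commute (h i) (h j)) (χ : ι → k) :
    ⨅ i ∈ s, (h i).maxGenEigenspace (χ i) ≤ (∑ i ∈ s, h i).maxGenEigenspace (∑ i ∈ s, χ i) := by
  classical
  induction s using Finset.induction_on with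
  | empty =>
    intro v _
    exact (mem_maxGenEigenspace _ _ _).2 ⟨1, by simp⟩
  | insert a s ha ih =>
    rw [Finset.sum_insert ha, Finset.sum_insert ha, Finset.iInf_insert]
    have hcs : Commute (h a) (∑ i ∈ s, h i) :=
      Commute.sum_right _ _ _ fun i hi => hc (by rintro rfl; exact ha hi)
    refine (inf_le_inf_left _ ih).trans ?_
    simpa [maxGenEigenspace] using genEigenspace_inf_le_add _ _ (χ a) (∑ i ∈ s, χ i) ⊤ ⊤ hcs

theorem maxGenEigenspace_le_smul (h : Module.End k V) (μ c : k) :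
    h.maxGenEigenspace μ ≤ (c • h).maxGenEigenspace (c * μ) := by
  simpa [mul_comm] using genEigenspace_le_smul h μ c ⊤

theorem iSup_maxGenEigenspace_smul_sum_eq_top [FiniteDimensional k V] {ι : Type*} [Fintype ι]
    (h : ι → Module.End k V) (hc : Pairwise fun i j => Commute (h i) (h j))
    (ht : ∀ i, ⨆ μ, (h i).maxGenEigenspace μ = ⊤) (c : k) :
    ⨆ μ, (c • ∑ i, h i).maxGenEigenspace μ = ⊤ := by
  rw [eq_top_iff,
    ← iSup_iInf_maxGenEigenspace_eq_top_of_iSup_maxGenEigenspace_eq_top_of_commute h hc ht]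
  refine iSup_le fun χ => le_iSup_of_le (c * ∑ i, χ i) ?_
  refine le_trans ?_ (maxGenEigenspace_le_smul _ _ _)
  simpa using iInf_maxGenEigenspace_le_sum Finset.univ h hc χ

/-- A commuting family of triangularizable endomorphisms has a common eigenvector in every nonzero
invariant submodule. -/
theorem exists_common_eigenvector [FiniteDimensional k V] {ι : Type*} [Fintype ι]
    (h : ι → Module.End k V) (hc : ∀ i j, Commute (h i) (h j))
    (ht : ∀ i, ⨆ μ, (h i).maxGenEigenspace μ = ⊤) (F : Submodule k V) (hF : F ≠ ⊥)
    (hFh : ∀ i, ∀ x ∈ F, h i x ∈ F) : ∃ y ∈ F, y ≠ 0 ∧ ∀ i, ∃ c : k, h i y = c • y := by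
  classical
  -- Invariance of `W` under all `h i`, not only those in `s`, keeps the induction going.
  suffices ∀ s : Finset ι, ∃ W ≤ F, W ≠ ⊥ ∧ (∀ i, ∀ x ∈ W, h i x ∈ W) ∧
      ∀ i ∈ s, ∃ c : k, ∀ y ∈ W, h i y = c • y by
    obtain ⟨W, hWF, hW, _, hWs⟩ := this Finset.univ
    obtain ⟨y, hyW, hy⟩ := Submodule.exists_mem_ne_zero_of_ne_bot hW
    exact ⟨y, hWF hyW, hy, fun i =>
      (hWs i (Finset.mem_univ i)).imp fun c hc => hc y hyW⟩
  intro s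
  induction s using Finset.induction_on with
  | empty => exact ⟨F, le_rfl, hF, hFh, by simp⟩
  | insert a s ha ih =>
    obtain ⟨W, hWF, hW, hWh, hWs⟩ := ih
    have : Nontrivial W := Submodule.nontrivial_iff_ne_bot.2 hW
    obtain ⟨c, hcW⟩ := exists_hasEigenvalue_of_genEigenspace_eq_top ⊤
      (genEigenspace_restrict_eq_top (hWh a) (ht a))
    obtain ⟨y, hy⟩ := hcW.exists_hasEigenvector
    refine ⟨W ⊓ (h a).eigenspace c, inf_le_left.trans hWF, ?_, ?_, ?_⟩
    · refine (Submodule.ne_bot_iff _).2 ⟨y, ⟨y.2, mem_eigenspace_iff.2 ?_⟩, ?_⟩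
      · exact congrArg Subtype.val hy.apply_eq_smul
      · exact fun h0 => hy.2 (Subtype.ext h0)
    · rintro i x ⟨hx, hxc⟩
      exact ⟨hWh i x hx, mapsTo_genEigenspace_of_comm (hc a i) c 1 hxc⟩
    · intro i hi
      rcases Finset.mem_insert.1 hi with rfl | hi
      · exact ⟨c, fun y hy => mem_eigenspace_iff.1 hy.2⟩
      · exact (hWs i hi).imp fun c hc y hy => hc y hy.1

variable [LinearOrder k]

/-- The sum of the generalized eigenspaces of `D` with eigenvalue at most `c`. -/
def eigenspacesLE (D : Module.End k V) (c : k) : Submodule k V :=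
  ⨆ μ, ⨆ (_ : μ ≤ c), D.maxGenEigenspace μ

/-- The sum of the generalized eigenspaces of `D` with eigenvalue larger than `c`. -/
def eigenspacesGT (D : Module.End k V) (c : k) : Submodule k V :=
  ⨆ μ, ⨆ (_ : c < μ), D.maxGenEigenspace μ

theorem apply_mem_eigenspacesLE {D T : Module.End k V} (h : Commute D T) (c : k) {x : V}
    (hx : x ∈ eigenspacesLE D c) : T x ∈ eigenspacesLE D c := by
  suffices eigenspacesLE D c ≤ (eigenspacesLE D c).comap T from this hx
  exact iSup₂_le fun ν hν x hx =>
    (le_iSup₂_of_le (f := fun ν (_ : ν ≤ c) => D.maxGenEigenspace ν) ν hν le_rfl)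
      (mapsTo_maxGenEigenspace_of_comm h ν hx)

theorem apply_mem_eigenspacesGT {D T : Module.End k V} (h : Commute D T) (c : k) {x : V}
    (hx : x ∈ eigenspacesGT D c) : T x ∈ eigenspacesGT D c := by
  suffices eigenspacesGT D c ≤ (eigenspacesGT D c).comap T from this hx
  exact iSup₂_le fun ν hν x hx =>
    (le_iSup₂_of_le (f := fun ν (_ : c < ν) => D.maxGenEigenspace ν) ν hν le_rfl)
      (mapsTo_maxGenEigenspace_of_comm h ν hx)

theorem isCompl_eigenspacesGT_eigenspacesLE {D : Module.End k V}
    (hD : ⨆ μ, D.maxGenEigenspace μ = ⊤) (c : k) :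
    IsCompl (eigenspacesGT D c) (eigenspacesLE D c) := by
  constructor
  · exact D.independent_maxGenEigenspace.disjoint_biSup_biSup (s := {μ | c < μ}) (t := {μ | μ ≤ c})
      (Set.disjoint_left.2 fun μ (h1 : c < μ) (h2 : μ ≤ c) => h1.not_ge h2)
  · rw [codisjoint_iff, eq_top_iff, ← hD]
    refine iSup_le fun μ => ?_
    rcases le_or_gt μ c with h | h
    · exact le_sup_of_le_right
        (le_iSup₂_of_le (f := fun ν (_ : ν ≤ c) => D.maxGenEigenspace ν) μ h le_rfl)
    · exact le_sup_of_le_left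
        (le_iSup₂_of_le (f := fun ν (_ : c < ν) => D.maxGenEigenspace ν) μ h le_rfl)

theorem eigenvalue_le_of_mem_eigenspacesLE {D : Module.End k V} {c μ : k} {y : V} (hy : y ≠ 0)
    (hDy : D y = μ • y) (hyc : y ∈ eigenspacesLE D c) : μ ≤ c := by
  by_contra hμ
  have hy' : y ∈ eigenspacesGT D c :=
    (le_iSup₂_of_le (f := fun ν (_ : c < ν) => D.maxGenEigenspace ν) μ (not_le.1 hμ)
      eigenspace_le_maxGenEigenspace) (mem_eigenspace_iff.2 hDy)
  exact hy (Submodule.disjoint_def.1 (D.independent_maxGenEigenspace.disjoint_biSup_biSup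
    (s := {μ | c < μ}) (t := {μ | μ ≤ c})
      (Set.disjoint_left.2 fun μ (h1 : c < μ) (h2 : μ ≤ c) => h1.not_ge h2)) _ hy' hyc)

end Weights

/-! ### The linear algebra of the root vectors -/

section Family

variable {V : Type*} [AddCommGroup V] [Module ℝ V]

/-- The relations, in a representation of `𝔰𝔩 (m + 1)`, among the root vectors `e i = E_{m+1,i}`,
`f i = E_{i,m+1}` and the coroots `h i = E_{m+1,m+1} - E_{i,i}`. -/
structure IsSlFamily {m : ℕ} (e f h : Fin m → Module.End ℝ V) : Prop where
  comm_h : ∀ i j, Commute (h i) (h j)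
  e_mul_f : ∀ i, e i * f i = f i * e i + h i
  h_mul_e : ∀ i j, h i * e j = e j * h i + (if i = j then (2 : ℝ) else 1) • e j
  h_mul_f : ∀ i, h i * f i = f i * h i + (-2 : ℝ) • f i

namespace IsSlFamily

variable {m : ℕ} {e f h : Fin m → Module.End ℝ V}

theorem h_mul_e_self (H : IsSlFamily e f h) (i : Fin m) :
    h i * e i = e i * h i + (2 : ℝ) • e i := by
  simpa using H.h_mul_e i i

/-- The weight of `e j` is `2` under `h j` and `1` under the other coroots: `m + 1` in total. -/
theorem average_mul_e (H : IsSlFamily e f h) (hm : 1 ≤ m) (j : Fin m) :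
    ((m : ℝ)⁻¹ • ∑ i, h i) * e j =
      e j * ((m : ℝ)⁻¹ • ∑ i, h i) + (1 + (m : ℝ)⁻¹) • e j := by
  have hm' : (m : ℝ) ≠ 0 := by positivity
  have hs : ∑ i : Fin m, (if i = j then (2 : ℝ) else 1) = m + 1 := by
    have : ∀ i : Fin m, (if i = j then (2 : ℝ) else 1) = (if i = j then 1 else 0) + 1 := by
      intro i; split_ifs <;> norm_num
    simp only [this, Finset.sum_add_distrib]
    simp [add_comm]
  rw [smul_mul_assoc, Finset.sum_mul, Finset.sum_congr rfl fun i _ => H.h_mul_e i j,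
    Finset.sum_add_distrib, ← Finset.sum_smul, hs, ← Finset.mul_sum, smul_add, mul_smul_comm,
    smul_smul]
  congr 2
  field_simp

variable [FiniteDimensional ℝ V]

theorem iSup_maxGenEigenspace_eq_top (H : IsSlFamily e f h) (i : Fin m) :
    ⨆ μ, (h i).maxGenEigenspace μ = ⊤ :=
  sl2_iSup_maxGenEigenspace_eq_top (H.e_mul_f i) (H.h_mul_e_self i) (H.h_mul_f i)

theorem iSup_maxGenEigenspace_average_eq_top (H : IsSlFamily e f h) (c : ℝ) :
    ⨆ μ, (c • ∑ i, h i).maxGenEigenspace μ = ⊤ :=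
  iSup_maxGenEigenspace_smul_sum_eq_top h (fun i j _ => H.comm_h i j)
    H.iSup_maxGenEigenspace_eq_top c

/-- If `e j ^ n` maps `y` into the sum of the eigenspaces of the average of the coroots with
eigenvalues at most `n (1 - χ) / m`, for all `j` and `n`, then `y` vanishes. -/
theorem eq_zero_of_forall_pow_mem (H : IsSlFamily e f h) (hm : 1 ≤ m) {χ : ℝ} (hχ : 0 < χ)
    (V₁ : Submodule ℝ V) (hV₁ : ∀ i, ∀ x ∈ V₁, h i x ∈ V₁)
    (hfix : ∀ x ∈ V₁, (∀ i, e i x = 0) → (∀ i, f i x = 0) → x = 0)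
    {x : V} (hx : x ∈ V₁)
    (hxe : ∀ j, ∀ n : ℕ, (e j ^ n) x ∈
      eigenspacesLE ((m : ℝ)⁻¹ • ∑ i, h i) (n * ((1 - χ) / m))) : x = 0 := by
  set D : Module.End ℝ V := (m : ℝ)⁻¹ • ∑ i, h i with hD
  have hm0 : (0 : ℝ) < m := by positivity
  have hDh : ∀ i, Commute D (h i) := fun i =>
    (Commute.sum_left _ _ _ fun j _ => H.comm_h j i).smul_left _
  let F : Submodule ℝ V :=
    V₁ ⊓ ⨅ j, ⨅ n : ℕ, (eigenspacesLE D (n * ((1 - χ) / m))).comap (e j ^ n)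
  have hmemF : ∀ y, y ∈ F ↔ y ∈ V₁ ∧ ∀ j, ∀ n : ℕ,
      (e j ^ n) y ∈ eigenspacesLE D (n * ((1 - χ) / m)) := fun y => by
    simp [F, Submodule.mem_iInf]
  suffices F = ⊥ from (Submodule.mem_bot ℝ).1 (this ▸ (hmemF x).2 ⟨hx, hxe⟩)
  by_contra hF
  -- `h i` commutes with `D`, and its commutator with `e j ^ n` is a multiple of `e j ^ n`.
  have hFh : ∀ i, ∀ y ∈ F, h i y ∈ F := by
    intro i y hy
    rw [hmemF] at hy ⊢
    refine ⟨hV₁ i y hy.1, fun j n => ?_⟩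
    have := congrArg (fun T : Module.End ℝ V => T y) (lie_pow_of_lie_eq (H.h_mul_e i j) n)
    simp only [Module.End.mul_apply, LinearMap.add_apply, LinearMap.smul_apply] at this
    rw [← sub_eq_iff_eq_add] at this
    rw [← this]
    exact sub_mem (apply_mem_eigenspacesLE (hDh i) _ (hy.2 j n))
      (Submodule.smul_mem _ _ (hy.2 j n))
  obtain ⟨y, hyF, hy, hev⟩ := exists_common_eigenvector h H.comm_h
    H.iSup_maxGenEigenspace_eq_top F hF hFh
  choose c hc using hev
  choose z hz using fun i =>
    sl2_eigenvalue_int (H.e_mul_f i) (H.h_mul_e_self i) (H.h_mul_f i) hy (hc i)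
  rw [hmemF] at hyF
  have hDy : D y = ((m : ℝ)⁻¹ * ∑ i, (z i : ℝ)) • y := by
    simp [hD, LinearMap.sum_apply, hc, hz, ← Finset.sum_smul, smul_smul]
  set lam : ℝ := (m : ℝ)⁻¹ * ∑ i, (z i : ℝ) with hlam
  have hDey : ∀ j, ∀ n : ℕ, D ((e j ^ n) y) = (lam + n * (1 + (m : ℝ)⁻¹)) • (e j ^ n) y := by
    intro j n
    have := congrArg (fun T : Module.End ℝ V => T y)
      (lie_pow_of_lie_eq (H.average_mul_e hm j) n)
    simp only [Module.End.mul_apply, LinearMap.add_apply, LinearMap.smul_apply, ← hD, hDy,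
      map_smul, ← add_smul] at this
    exact this
  have hle : ∀ j, ∀ n : ℕ, (e j ^ n) y ≠ 0 → lam + n * (1 + (m : ℝ)⁻¹) ≤ n * ((1 - χ) / m) :=
    fun j n hne => eigenvalue_le_of_mem_eigenspacesLE hne (hDey j n) (hyF.2 j n)
  -- The terms `n / m` cancel; the surplus `n χ / m` gives the strict contradictions below.
  have hle' : ∀ j, ∀ n : ℕ, (e j ^ n) y ≠ 0 → lam + n + n * (χ * (m : ℝ)⁻¹) ≤ 0 := by
    intro j n hne
    have := hle j n hne
    rw [div_eq_mul_inv] at this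
    linarith
  obtain ⟨i₀⟩ : Nonempty (Fin m) := ⟨⟨0, hm⟩⟩
  have hlam0 : lam ≤ 0 := by simpa using hle' i₀ 0 (by simpa using hy)
  have hminv : 0 < (m : ℝ)⁻¹ := inv_pos.2 hm0
  -- The minimal weight is at most the mean `lam`, so `-z j` raisings by `e j` already overshoot.
  obtain ⟨j, -, hj⟩ := Finset.exists_min_image Finset.univ z ⟨i₀, Finset.mem_univ _⟩
  have hjlam : (z j : ℝ) ≤ lam := by
    rw [hlam, inv_mul_eq_div, le_div_iff₀ hm0]
    have := Finset.card_nsmul_le_sum Finset.univ (fun i => (z i : ℝ)) (z j)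
      fun i hi => by exact_mod_cast hj i hi
    simpa [mul_comm] using this
  rcases lt_or_ge (z j) 0 with hneg | hnonneg
  · obtain ⟨n, hn⟩ := Int.eq_ofNat_of_zero_le (by omega : 0 ≤ -z j)
    have hzn : z j = -(n : ℤ) := by omega
    have hne : (e j ^ n) y ≠ 0 := sl2_pow_apply_ne_zero (H.e_mul_f j) (H.h_mul_e_self j)
      (H.h_mul_f j) hy le_rfl (by rw [hc, hz, hzn]; push_cast; rfl)
    have h1 := hle' j n hne
    rw [hzn] at hjlam
    push_cast at hjlam
    have hn0 : (0 : ℝ) < n := by exact_mod_cast (by omega : 0 < n)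
    have : 0 < n * (χ * (m : ℝ)⁻¹) := by positivity
    linarith
  · have hlam1 : lam = 0 := le_antisymm hlam0 ((by exact_mod_cast hnonneg : (0 : ℝ) ≤ z j).trans hjlam)
    have hz0 : ∀ i, z i = 0 := by
      have hsum : ∑ i, (z i : ℝ) = 0 := by
        rw [hlam] at hlam1
        exact (mul_eq_zero.1 hlam1).resolve_left hminv.ne'
      intro i
      have := (Finset.sum_eq_zero_iff_of_nonneg (fun i hi => by
        exact_mod_cast hnonneg.trans (hj i hi))).1 hsum i (Finset.mem_univ i)
      exact_mod_cast this
    have hey : ∀ i, e i y = 0 := by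
      intro i
      by_contra hne
      have := hle' i 1 (by simpa using hne)
      have h3 : 0 < χ * (m : ℝ)⁻¹ := by positivity
      rw [hlam1] at this
      push_cast at this
      linarith
    refine hy (hfix y hyF.1 hey fun i => ?_)
    exact sl2_lower_eq_zero (H.e_mul_f i) (H.h_mul_e_self i) (H.h_mul_f i) (hey i)
      (by rw [hc, hz, hz0]; simp)

end IsSlFamily

end Family

/-! ### Identities and generators in the special linear group -/

section Elementary

open Matrix.SpecialLinearGroup

variable {ι F : Type*} [Fintype ι] [DecidableEq ι] [Field F]

theorem diag2n_eq_one_add_single {i j : ι} (hij : i ≠ j) {a : F} (ha : a ≠ 0) :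
    (diag2n hij a ha).1 = 1 + single i i (a - 1) + single j j (a⁻¹ - 1) := by
  rw [diag2n_coe]
  ext p q
  simp only [diagonal_apply, Matrix.add_apply, one_apply, single_apply]
  grind

theorem exists_single_eq_smul (ι F : Type*) [DecidableEq ι] [Field F] :
    ∃ E : ι → ι → Matrix ι ι F, ∀ i j c, single i j c = c • E i j :=
  ⟨fun i j => single i j 1, fun i j c => by simp [smul_single]⟩

/-- The Gauss decomposition in a `2 × 2` block. It serves twice: to express diagonal elements by
transvections, and, differentiated, to give `[e, f] = h`. -/
theorem transvection_mul_transvection_swap {i j : ι} (hij : i ≠ j) {x y : F}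
    (hc : 1 + x * y ≠ 0) :
    transvection hij x * transvection hij.symm y =
      transvection hij.symm (y / (1 + x * y)) * diag2n hij (1 + x * y) hc *
        transvection hij (x / (1 + x * y)) := by
  obtain ⟨E, hE⟩ := exists_single_eq_smul ι F
  have hc' : 1 + y * x ≠ 0 := by rwa [mul_comm y x]
  apply Subtype.ext
  simp only [coe_mul, diag2n_eq_one_add_single, transvection_coe, mul_add, add_mul, one_mul,
    mul_one, single_mul_single_same, single_mul_single_of_ne _ _ _ _ hij,
    single_mul_single_of_ne _ _ _ _ hij.symm, add_zero]
  simp only [hE]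
  match_scalars <;> field_simp <;> ring

theorem diag2n_mul_transvection {i j : ι} (hij : i ≠ j) {a : F} (ha : a ≠ 0) {k l : ι}
    (hkl : k ≠ l) (x : F) :
    diag2n hij a ha * transvection hkl x =
      transvection hkl ((if k = i then a else if k = j then a⁻¹ else 1) * x *
        (if l = i then a else if l = j then a⁻¹ else 1)⁻¹) * diag2n hij a ha := by
  apply Subtype.ext
  simp only [coe_mul, diag2n_coe, transvection_coe, mul_add, add_mul, one_mul, mul_one]
  congr 1
  ext p q
  simp only [diagonal_mul, mul_diagonal, single_apply]
  have : (if l = i then a else if l = j then a⁻¹ else 1) ≠ 0 := by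
    split_ifs <;> simp [ha]
  by_cases h : k = p ∧ l = q
  · obtain ⟨rfl, rfl⟩ := h
    simp only [and_self, if_true]
    rw [mul_assoc _ _ (ite _ _ _), inv_mul_cancel₀ this, mul_one]
  · simp [h]

theorem diag2n_commute {i j k l : ι} (hij : i ≠ j) (hkl : k ≠ l) {a b : F} (ha : a ≠ 0)
    (hb : b ≠ 0) : Commute (diag2n hij a ha) (diag2n hkl b hb) := by
  apply Subtype.ext
  simp only [coe_mul, diag2n_coe, diagonal_mul_diagonal, mul_comm]

theorem diag2n_mul_diag2n {i j : ι} (hij : i ≠ j) {a b : F} (ha : a ≠ 0) (hb : b ≠ 0) :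
    diag2n hij a ha * diag2n hij b hb = diag2n hij (a * b) (mul_ne_zero ha hb) := by
  apply Subtype.ext
  simp only [coe_mul, diag2n_coe, diagonal_mul_diagonal]
  congr 1
  ext p
  split_ifs <;> simp [mul_comm]

theorem transvection_eq_commutator {i j l : ι} (hij : i ≠ j) (hil : i ≠ l) (hlj : l ≠ j) (x : F) :
    transvection hij x = transvection hil x * transvection hlj 1 * (transvection hil x)⁻¹ *
      (transvection hlj 1)⁻¹ := by
  obtain ⟨E, hE⟩ := exists_single_eq_smul ι F
  rw [transvection_inv, transvection_inv]
  apply Subtype.ext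
  simp only [coe_mul, transvection_coe, mul_add, add_mul, one_mul,
    mul_one, single_mul_single_same,
    single_mul_single_of_ne _ _ _ _ hij.symm,
    single_mul_single_of_ne _ _ _ _ hil.symm,
    single_mul_single_of_ne _ _ _ _ hlj.symm, add_zero]
  simp only [hE]
  module

/-- The transvections in the row and in the column of a fixed index generate `SL`. -/
theorem eq_top_of_transvection_mem [Nontrivial ι] (S : Subgroup (SpecialLinearGroup ι F)) (l : ι)
    (h₁ : ∀ (j : ι) (hj : l ≠ j) (x : F), transvection hj x ∈ S)
    (h₂ : ∀ (j : ι) (hj : j ≠ l) (x : F), transvection hj x ∈ S) : S = ⊤ := by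
  have htr : ∀ (i j : ι) (hij : i ≠ j) (x : F), transvection hij x ∈ S := by
    intro i j hij x
    by_cases hi : i = l
    · subst hi; exact h₁ j hij x
    by_cases hj : j = l
    · subst hj; exact h₂ i hij x
    rw [transvection_eq_commutator hij hi (Ne.symm hj)]
    exact S.mul_mem (S.mul_mem (S.mul_mem (h₂ _ _ _) (h₁ _ _ _)) (S.inv_mem (h₂ _ _ _)))
      (S.inv_mem (h₁ _ _ _))
  refine eq_top_iff.2 fun g _ => diagonal_transvection_induction' (· ∈ S) g ?_ htr
    fun _ _ => S.mul_mem
  intro i j hij c hc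
  have hc' : 1 + (c - 1) * 1 = c := by ring
  have := transvection_mul_transvection_swap hij (x := c - 1) (y := 1) (by rwa [hc'])
  simp only [hc'] at this
  have h3 : diag2n hij c hc = (transvection hij.symm (1 / c))⁻¹ *
      (transvection hij (c - 1) * transvection hij.symm 1) *
        (transvection hij ((c - 1) / c))⁻¹ := by rw [this]; group
  rw [h3]
  exact S.mul_mem (S.mul_mem (S.inv_mem (htr _ _ _ _)) (S.mul_mem (htr _ _ _ _) (htr _ _ _ _)))
    (S.inv_mem (htr _ _ _ _))

theorem continuous_transvection {i j : ι} (hij : i ≠ j) :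
    Continuous fun x : ℝ => transvection hij x := by
  refine continuous_induced_rng.2 (continuous_matrix fun p q => ?_)
  change Continuous fun x : ℝ => (1 + single i j x : Matrix ι ι ℝ) p q
  simp only [Matrix.add_apply, single_apply]
  split_ifs <;> fun_prop

theorem continuous_diag2n_exp {i j : ι} (hij : i ≠ j) :
    Continuous fun s : ℝ => diag2n hij (Real.exp s) (Real.exp_ne_zero s) := by
  refine continuous_induced_rng.2 (continuous_matrix fun p q => ?_)
  change Continuous fun s : ℝ => (diagonal fun k : ι => if k = i then Real.exp s else
    if k = j then (Real.exp s)⁻¹ else 1) p q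
  simp only [diagonal_apply]
  split_ifs <;> first | fun_prop | exact Real.continuous_exp.inv₀ Real.exp_ne_zero

end Elementary

/-! ### One-parameter subgroups and their commutators -/

section OneParameter

open NormedSpace Filter Topology

variable {A : Type*} [NormedRing A] [NormedAlgebra ℝ A] [CompleteSpace A]

/-- A continuous one-parameter subgroup of a Banach algebra is an exponential. -/
theorem exists_eq_exp_smul_of_continuous {φ : ℝ → A} (hφ : Continuous φ) (h0 : φ 0 = 1)
    (hadd : ∀ s t, φ (s + t) = φ s * φ t) : ∃ a : A, ∀ s, φ s = exp (s • a) := by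
  set Φ : ℝ → A := fun x => ∫ s in (0 : ℝ)..x, φ s with hΦ
  have hΦ' : ∀ x, HasDerivAt Φ (φ x) x := fun x =>
    intervalIntegral.integral_hasDerivAt_right (hφ.intervalIntegrable _ _)
      (hφ.stronglyMeasurableAtFilter _ _) hφ.continuousAt
  -- The means of `φ` over `[0, ε]` tend to `φ 0 = 1`, so one is invertible. Dividing `Φ (x + ε) - Φ
  -- x = φ x * Φ ε` by it shows that `φ` is differentiable.
  obtain ⟨ε, hε0, hε⟩ : ∃ ε : ℝ, ε ≠ 0 ∧ IsUnit (ε⁻¹ • Φ ε) := by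
    have h1 : Tendsto (fun ε : ℝ => ε⁻¹ • Φ ε) (𝓝[≠] 0) (𝓝 1) := by
      have := (hΦ' 0).tendsto_slope_zero
      simpa [hΦ, h0] using this
    have h2 : ∀ᶠ ε in 𝓝[≠] (0 : ℝ), IsUnit (ε⁻¹ • Φ ε) :=
      h1.eventually (Units.isOpen.mem_nhds isUnit_one)
    obtain ⟨ε, h3, h4⟩ := (h2.and self_mem_nhdsWithin).exists
    exact ⟨ε, h4, h3⟩
  obtain ⟨u, hu⟩ := hε
  have hshift : ∀ x, φ x = (ε⁻¹ • (Φ (x + ε) - Φ x)) * (↑u⁻¹ : A) := by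
    intro x
    rw [Units.eq_mul_inv_iff_mul_eq, hu, mul_smul_comm]
    congr 1
    have h1 := (ContinuousLinearMap.mul ℝ A (φ x)).intervalIntegral_comp_comm
      (hφ.intervalIntegrable (μ := MeasureTheory.volume) 0 ε)
    simp only [ContinuousLinearMap.mul_apply', ← hadd] at h1
    rw [hΦ]
    simp only
    rw [← h1, intervalIntegral.integral_interval_sub_left (hφ.intervalIntegrable _ _)
      (hφ.intervalIntegrable _ _)]
    simp

  set a : A := (ε⁻¹ • (φ (0 + ε) - φ 0)) * (↑u⁻¹ : A) with ha
  have hd0 : HasDerivAt φ a 0 := by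
    have h1 : HasDerivAt (fun x => (ε⁻¹ • (Φ (x + ε) - Φ x)) * (↑u⁻¹ : A)) a 0 :=
      ((((hΦ' (0 + ε)).comp_add_const 0 ε).sub (hΦ' 0)).const_smul ε⁻¹).mul_const _
    exact h1.congr_of_eventuallyEq (Eventually.of_forall hshift)
  have hd : ∀ x, HasDerivAt φ (φ x * a) x := by
    intro x
    have h1 : HasDerivAt (fun y => φ x * φ (y - x)) (φ x * a) x := by
      refine HasDerivAt.const_mul _ ?_
      refine HasDerivAt.comp_sub_const x x ?_
      rwa [sub_self]
    refine h1.congr_of_eventuallyEq (Eventually.of_forall fun y => ?_)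
    simp only [← hadd, add_sub_cancel]
  refine ⟨a, fun s => ?_⟩
  have hexp : ∀ x : ℝ, HasDerivAt (fun x : ℝ => exp (x • -a)) (-a * exp (x • -a)) x := fun x =>
    hasDerivAt_exp_smul_const' (-a) x
  have hconst := is_const_of_deriv_eq_zero (f := fun x => φ x * exp (x • -a))
    (fun x => ((hd x).fun_mul (hexp x)).differentiableAt)
    (fun x => by rw [((hd x).fun_mul (hexp x)).deriv]; noncomm_ring)
  have h1 : φ s * exp (s • -a) = 1 := by simpa [h0] using hconst s 0
  have h2 : exp (s • -a) * exp (s • a) = 1 := by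
    let _ : NormedAlgebra ℚ A := NormedAlgebra.restrictScalars ℚ ℝ A
    rw [smul_neg, ← NormedSpace.exp_add_of_commute (Commute.refl (s • a)).neg_left, neg_add_cancel, exp_zero]
  calc φ s = φ s * (exp (s • -a) * exp (s • a)) := by rw [h2, mul_one]
    _ = exp (s • a) := by rw [← mul_assoc, h1, one_mul]

/-- Differentiate at `x = 0`, then at `s = 0`. -/
theorem lie_eq_smul_of_exp_conj {h e : A} {c : ℝ}
    (H : ∀ s x : ℝ, exp (s • h) * exp (x • e) = exp ((x * Real.exp (c * s)) • e) * exp (s • h)) :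
    h * e = e * h + c • e := by
  have h1 : ∀ s : ℝ, exp (s • h) * e = (Real.exp (c * s) • e) * exp (s • h) := by
    intro s
    have hl : HasDerivAt (fun x : ℝ => exp (s • h) * exp (x • e)) (exp (s • h) * (e)) 0 := by
      simpa using (hasDerivAt_exp_smul_const e (0 : ℝ)).const_mul (exp (s • h))
    have hr : HasDerivAt (fun x : ℝ => exp ((x * Real.exp (c * s)) • e) * exp (s • h))
        ((Real.exp (c * s) • e) * exp (s • h)) 0 := by
      simp_rw [mul_smul]
      simpa using (hasDerivAt_exp_smul_const (Real.exp (c * s) • e) (0 : ℝ)).mul_const (exp (s • h))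
    exact hl.unique (hr.congr_of_eventuallyEq (Eventually.of_forall (H s)))
  have hl : HasDerivAt (fun s : ℝ => exp (s • h) * e) (h * e) 0 := by
    simpa using (hasDerivAt_exp_smul_const h (0 : ℝ)).mul_const e
  have hr : HasDerivAt (fun s : ℝ => (Real.exp (c * s) • e) * exp (s • h)) (c • e + e * h) 0 := by
    have h2 : HasDerivAt (fun s : ℝ => Real.exp (c * s)) c 0 := by
      simpa using ((hasDerivAt_id (0 : ℝ)).const_mul c).exp
    simpa using (h2.smul_const e).fun_mul (hasDerivAt_exp_smul_const h (0 : ℝ))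
  rw [hl.unique (hr.congr_of_eventuallyEq (Eventually.of_forall h1)), add_comm]

theorem lie_eq_of_exp_mul_exp {e f h : A}
    (H : ∀ x y : ℝ, 0 < 1 + x * y → exp (x • e) * exp (y • f) =
      exp ((y / (1 + x * y)) • f) * exp (Real.log (1 + x * y) • h) *
        exp ((x / (1 + x * y)) • e)) : e * f = f * e + h := by
  have hexp : ∀ (a : A) (u : ℝ → ℝ) (u' : ℝ) (x : ℝ), HasDerivAt u u' x →
      HasDerivAt (fun x => exp (u x • a)) (u' • (exp (u x • a) * a)) x := fun a u u' x hu =>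
    (hasDerivAt_exp_smul_const a (u x)).scomp x hu
  -- The `x`-derivative at `0`: the three exponents on the right have derivatives `-y ^ 2`, `y` and
  -- `1`. The `y`-derivative at `0` then gives the claim.
  have h1 : ∀ y : ℝ, e * exp (y • f) =
      (-y ^ 2) • (exp (y • f) * f) + y • (exp (y • f) * h) + exp (y • f) * e := by
    intro y
    have hl : HasDerivAt (fun x : ℝ => exp (x • e) * exp (y • f)) (e * exp (y • f)) 0 := by
      simpa using (hasDerivAt_exp_smul_const e (0 : ℝ)).mul_const (exp (y • f))
    have hc : HasDerivAt (fun x : ℝ => 1 + x * y) y 0 := by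
      simpa using ((hasDerivAt_id (0 : ℝ)).mul_const y).const_add 1
    have hA : HasDerivAt (fun x : ℝ => y / (1 + x * y)) (-y ^ 2) 0 := by
      have := (hasDerivAt_const (0 : ℝ) y).fun_div hc (by simp)
      simpa [pow_two] using this
    have hB : HasDerivAt (fun x : ℝ => Real.log (1 + x * y)) y 0 := by
      simpa using hc.log (by simp)
    have hC : HasDerivAt (fun x : ℝ => x / (1 + x * y)) 1 0 := by
      simpa using (hasDerivAt_id' (0 : ℝ)).fun_div hc (by simp)
    have hr := ((hexp f _ _ _ hA).fun_mul (hexp h _ _ _ hB)).fun_mul (hexp e _ _ _ hC)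
    simp only [zero_mul, add_zero, div_one, Real.log_one, zero_smul, exp_zero, mul_one, one_mul,
      one_smul, mul_smul_comm] at hr
    refine hl.unique (hr.congr_of_eventuallyEq ?_)
    have : ∀ᶠ x : ℝ in 𝓝 0, 0 < 1 + x * y :=
      hc.continuousAt.eventually_const_lt (by simp)
    filter_upwards [this] with x hx using H x y hx
  have hl : HasDerivAt (fun y : ℝ => e * exp (y • f)) (e * f) 0 := by
    simpa using (hasDerivAt_exp_smul_const f (0 : ℝ)).const_mul e
  have hf := hasDerivAt_exp_smul_const f (0 : ℝ)
  have h2 : HasDerivAt (fun y : ℝ => -y ^ 2) 0 0 := by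
    simpa using ((hasDerivAt_id' (0 : ℝ)).fun_pow 2).fun_neg
  have hr := ((h2.fun_smul (hf.mul_const f)).fun_add
    ((hasDerivAt_id' (0 : ℝ)).fun_smul (hf.mul_const h))).fun_add (hf.mul_const e)
  have := hl.unique (hr.congr_of_eventuallyEq (Eventually.of_forall h1))
  simpa [add_comm] using this

end OneParameter

/-! ### Quantitative expansion under the flow -/

section Expansion

open Filter Topology

variable {V : Type*} [NormedAddCommGroup V] [NormedSpace ℝ V]

theorem coe_pow_apply (a : V →L[ℝ] V) (n : ℕ) (v : V) :
    ((a : Module.End ℝ V) ^ n) v = (a ^ n) v := by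
  induction n generalizing v with
  | zero => simp
  | succ n ih => simp [pow_succ, ih]

variable [FiniteDimensional ℝ V]

theorem exp_smul_apply_of_pow_apply_eq_zero (a : V →L[ℝ] V) {n : ℕ} {v : V} (hv : (a ^ n) v = 0)
    (s : ℝ) :
    NormedSpace.exp (s • a) v = ∑ k ∈ Finset.range n, (s ^ k * (k.factorial : ℝ)⁻¹) • (a ^ k) v := by
  have h1 := (NormedSpace.exp_series_hasSum_exp' (𝕂 := ℝ) (s • a)).mapL
    (ContinuousLinearMap.apply ℝ V v)
  refine h1.unique ?_
  have h2 : ∀ k : ℕ, ContinuousLinearMap.apply ℝ V v (((k.factorial : ℝ)⁻¹) • (s • a) ^ k) =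
      (s ^ k * (k.factorial : ℝ)⁻¹) • (a ^ k) v := by
    intro k
    simp [smul_pow, smul_smul, mul_comm]
  simp_rw [h2]
  refine hasSum_sum_of_ne_finset_zero fun k hk => ?_
  obtain ⟨l, rfl⟩ := Nat.exists_eq_add_of_le (not_lt.1 (by simpa using hk) : n ≤ k)
  have h3 : (a ^ (n + l)) v = 0 := by
    rw [add_comm, pow_add]
    change (a ^ l) ((a ^ n) v) = 0
    rw [hv, map_zero]
  rw [h3, smul_zero]

theorem exp_add_smul_one (a : V →L[ℝ] V) (c : ℝ) :
    NormedSpace.exp (a + c • 1) = Real.exp c • NormedSpace.exp a := by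
  let _ : NormedAlgebra ℚ (V →L[ℝ] V) := NormedAlgebra.restrictScalars ℚ ℝ _
  rw [NormedSpace.exp_add_of_commute ((Commute.one_right a).smul_right c),
    ← Algebra.algebraMap_eq_smul_one, ← NormedSpace.algebraMap_exp_comm, ← Real.exp_eq_exp_ℝ,
    Algebra.algebraMap_eq_smul_one, mul_smul_comm, mul_one]

/-- On the generalized eigenspace of `μ > c`, the flow is `exp (-μ s)` times a polynomial in `s`. -/
theorem tendsto_exp_neg_smul_apply {a : V →L[ℝ] V} {c : ℝ} {v : V}
    (hv : v ∈ eigenspacesGT (a : Module.End ℝ V) c) :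
    Tendsto (fun s : ℝ => Real.exp (c * s) • NormedSpace.exp (-s • a) v) atTop (𝓝 0) := by
  let W : Submodule ℝ V :=
    { carrier := {v | Tendsto (fun s : ℝ => Real.exp (c * s) • NormedSpace.exp (-s • a) v)
        atTop (𝓝 0)}
      zero_mem' := by simp
      add_mem' := fun {x y} hx hy => by
        simpa [smul_add] using Tendsto.add hx hy
      smul_mem' := fun r x hx => by
        have := Tendsto.const_smul (show Tendsto _ _ _ from hx) r
        simpa [smul_comm r] using this }
  suffices eigenspacesGT (a : Module.End ℝ V) c ≤ W from this hv
  refine iSup₂_le fun μ hμ v hv => ?_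
  obtain ⟨n, hn⟩ := (Module.End.mem_maxGenEigenspace _ _ _).1 hv
  have hn' : ((a - μ • 1) ^ n) v = 0 := by
    rw [← coe_pow_apply]
    exact hn
  have key : ∀ s : ℝ, Real.exp (c * s) • NormedSpace.exp (-s • a) v =
      ∑ k ∈ Finset.range n, ((s ^ k / Real.exp ((μ - c) * s)) * ((-1) ^ k * (k.factorial : ℝ)⁻¹)) •
        ((a - μ • 1) ^ k) v := by
    intro s
    have h1 : -s • a = -s • (a - μ • 1) + (-s * μ) • 1 := by module
    rw [h1, exp_add_smul_one, _root_.smul_apply,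
      exp_smul_apply_of_pow_apply_eq_zero _ hn', smul_smul, ← Real.exp_add, Finset.smul_sum]
    refine Finset.sum_congr rfl fun k _ => ?_
    rw [smul_smul, div_eq_mul_inv, ← Real.exp_neg, neg_pow s,
      show c * s + -s * μ = -((μ - c) * s) by ring]
    congr 1
    ring
  change Tendsto _ _ _
  simp_rw [key]
  rw [← Finset.sum_const_zero (s := Finset.range n)]
  refine tendsto_finsetSum _ fun k _ => ?_
  have h2 := (isLittleO_pow_exp_pos_mul_atTop (k := k) (sub_pos.2 hμ)).tendsto_div_nhds_zero
  simpa using (h2.mul_const ((-1) ^ k * (k.factorial : ℝ)⁻¹)).smul_const (((a - μ • 1) ^ k) v)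

/-- Take the projection onto the eigenvalues above `c`. It commutes with the flow, so `π v = exp (-s
a) π (exp (s a) v)`, and `exp (c s) • exp (-s a) π` tends to `0` in norm, as is checked on a basis.
-/
theorem exists_projection_forall_norm_le {a : V →L[ℝ] V}
    (ha : ⨆ μ, Module.End.maxGenEigenspace (a : Module.End ℝ V) μ = ⊤) (c : ℝ) :
    ∃ π : V →ₗ[ℝ] V, LinearMap.ker π = eigenspacesLE (a : Module.End ℝ V) c ∧
      ∀ ε : ℝ, 0 < ε → ∀ᶠ s : ℝ in atTop, ∀ v : V,
        ‖π v‖ ≤ ε * (Real.exp (-(c * s)) * ‖NormedSpace.exp (s • a) v‖) := by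
  have hcompl := isCompl_eigenspacesGT_eigenspacesLE ha c
  set π : V →ₗ[ℝ] V := Submodule.projection _ _ hcompl with hπ
  refine ⟨π, Submodule.ker_projection hcompl, fun ε hε => ?_⟩
  have hcomm : Commute π (a : Module.End ℝ V) := by
    rw [LinearMap.IsIdempotentElem.commute_iff (Submodule.isIdempotentElem_projection hcompl)]
    rw [Submodule.range_projection, Submodule.ker_projection]
    exact ⟨fun x hx => apply_mem_eigenspacesGT (Commute.refl _) c hx,
      fun x hx => apply_mem_eigenspacesLE (Commute.refl _) c hx⟩
  set P : V →L[ℝ] V := LinearMap.toContinuousLinearMap π with hP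
  have hcomm' : Commute P a := by
    ext v
    exact congrArg (fun T : Module.End ℝ V => T v) hcomm
  let b := Module.finBasis ℝ V
  obtain ⟨C, hC, hCb⟩ := b.exists_opNorm_le (F := V)
  have hev : ∀ᶠ s : ℝ in atTop, ∀ i,
      ‖Real.exp (c * s) • NormedSpace.exp (-s • a) (π (b i))‖ ≤ ε / C := by
    refine eventually_all.2 fun i => ?_
    have h1 := (tendsto_exp_neg_smul_apply (a := a) (c := c)
      (Submodule.projection_apply_mem hcompl (b i))).norm
    rw [norm_zero] at h1
    exact (h1.eventually_lt_const (by positivity : 0 < ε / C)).mono fun s hs => hs.le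
  filter_upwards [hev] with s hs v
  have hT : ‖Real.exp (c * s) • (NormedSpace.exp (-s • a) * P)‖ ≤ ε := by
    refine (hCb (u := Real.exp (c * s) • (NormedSpace.exp (-s • a) * P))
      (by positivity : 0 ≤ ε / C) hs).trans_eq ?_
    field_simp
  have hid : P = NormedSpace.exp (-s • a) * P * NormedSpace.exp (s • a) := by
    let _ : NormedAlgebra ℚ (V →L[ℝ] V) := NormedAlgebra.restrictScalars ℚ ℝ _
    have h2 : Commute P (NormedSpace.exp (s • a)) := (hcomm'.smul_right s).exp_right
    rw [mul_assoc, h2.eq, ← mul_assoc, neg_smul,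
      ← NormedSpace.exp_add_of_commute (Commute.refl (s • a)).neg_left, neg_add_cancel,
      NormedSpace.exp_zero, one_mul]
  have hv : π v = (Real.exp (c * s) • (NormedSpace.exp (-s • a) * P))
      (Real.exp (-(c * s)) • NormedSpace.exp (s • a) v) := by
    rw [_root_.smul_apply, map_smul, smul_smul, ← Real.exp_add, add_neg_cancel,
      Real.exp_zero, one_smul, ← mul_apply_eq_comp, ← hid]
    rfl
  rw [hv]
  refine (ContinuousLinearMap.le_of_opNorm_le _ hT _).trans_eq ?_
  rw [norm_smul, Real.norm_eq_abs, Real.abs_exp]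

/-- Coefficients are recovered from the values at the nodes `i / n` by inverting a Vandermonde
matrix. -/
theorem exists_norm_coeff_le (V : Type*) [NormedAddCommGroup V] [NormedSpace ℝ V] (n : ℕ) :
    ∃ C : ℝ, 0 < C ∧ ∀ (w : ℕ → V) (M : ℝ), (∀ σ : ℝ, |σ| < 1 →
      ‖∑ k ∈ Finset.range n, σ ^ k • w k‖ ≤ M) → ∀ k < n, ‖w k‖ ≤ C * M := by
  let x : Fin n → ℝ := fun i => (i : ℝ) / n
  let A := Matrix.vandermonde x
  have hx : Function.Injective x := by
    intro i j hij
    have hn : (n : ℝ) ≠ 0 := by have := i.pos; positivity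
    exact Fin.ext (by exact_mod_cast (div_left_inj' hn).1 hij)
  have hdet : IsUnit A.det := isUnit_iff_ne_zero.2 (Matrix.det_vandermonde_ne_zero_iff.2 hx)
  refine ⟨1 + ∑ k, ∑ i, |A⁻¹ k i|, by positivity, fun w M hw k hk => ?_⟩
  have hM : 0 ≤ M := (norm_nonneg _).trans (hw 0 (by simp))
  have hsum : w k = ∑ i, A⁻¹ ⟨k, hk⟩ i • ∑ l ∈ Finset.range n, x i ^ l • w l := by
    simp_rw [Finset.sum_range, Finset.smul_sum, smul_smul]
    rw [Finset.sum_comm]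
    simp_rw [← Finset.sum_smul]
    have h1 : ∀ l : Fin n, ∑ i, A⁻¹ ⟨k, hk⟩ i * x i ^ (l : ℕ) =
        (1 : Matrix (Fin n) (Fin n) ℝ) ⟨k, hk⟩ l := fun l => by
      rw [← Matrix.nonsing_inv_mul A hdet, Matrix.mul_apply]
      rfl
    simp [h1, Matrix.one_apply]
  rw [hsum]
  have hxi : ∀ i, |x i| < 1 := fun i => by
    have hn : (0 : ℝ) < n := by have := i.pos; positivity
    rw [abs_of_nonneg (by positivity), div_lt_one hn]
    exact_mod_cast i.2
  calc ‖∑ i, A⁻¹ ⟨k, hk⟩ i • ∑ l ∈ Finset.range n, x i ^ l • w l‖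
      ≤ ∑ i, |A⁻¹ ⟨k, hk⟩ i| * M := by
        refine norm_sum_le_of_le _ fun i _ => ?_
        rw [norm_smul, Real.norm_eq_abs]
        exact mul_le_mul_of_nonneg_left (hw _ (hxi i)) (abs_nonneg _)
    _ = (∑ i, |A⁻¹ ⟨k, hk⟩ i|) * M := by rw [Finset.sum_mul]
    _ ≤ _ := by
        refine mul_le_mul_of_nonneg_right ?_ hM
        have := Finset.single_le_sum (f := fun k => ∑ i, |A⁻¹ k i|)
          (fun _ _ => by positivity) (Finset.mem_univ (⟨k, hk⟩ : Fin n))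
        linarith

/-- Vectors of `V₁` are uniformly expanded by the flow `exp (s D)`, where `D` is the average of the
coroots, after a small push along one of the unipotent directions `e j`. -/
theorem IsSlFamily.eventually_norm_le {m : ℕ} (hm : 1 ≤ m) {e f h : Fin m → V →L[ℝ] V}
    (H : IsSlFamily (fun i => (e i : Module.End ℝ V)) (fun i => (f i : Module.End ℝ V))
      fun i => (h i : Module.End ℝ V)) {χ : ℝ} (hχ : 0 < χ)
    (V₁ : Submodule ℝ V) (hV₁ : ∀ i, ∀ x ∈ V₁, h i x ∈ V₁)
    (hfix : ∀ x ∈ V₁, (∀ i, e i x = 0) → (∀ i, f i x = 0) → x = 0) {ε : ℝ} (hε : 0 < ε) :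
    ∀ᶠ s : ℝ in atTop, ∀ y ∈ V₁, ∀ M : ℝ, (∀ j, ∀ σ : ℝ, |σ| < 1 →
      ‖NormedSpace.exp (s • (m : ℝ)⁻¹ • ∑ i, h i)
        (NormedSpace.exp ((Real.exp (-((1 - χ) / m * s)) * σ) • e j) y)‖ ≤ M) → ‖y‖ ≤ ε * M := by
  set D : V →L[ℝ] V := (m : ℝ)⁻¹ • ∑ i, h i with hD
  have hDcoe : (D : Module.End ℝ V) = (m : ℝ)⁻¹ • ∑ i, (h i : Module.End ℝ V) := by
    ext v; simp [hD]
  obtain ⟨n, hn⟩ : ∃ n : ℕ, ∀ j, e j ^ n = 0 := by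
    have h1 : ∀ j, ∃ n : ℕ, (e j : Module.End ℝ V) ^ n = 0 := fun j =>
      isNilpotent_of_lie_eq_smul (by norm_num) (H.h_mul_e_self j)
    choose n hn using h1
    refine ⟨∑ j, n j, fun j => ?_⟩
    have h2 : e j ^ n j = 0 := by
      ext v
      rw [← coe_pow_apply, hn]
      rfl
    exact pow_eq_zero_of_le (Finset.single_le_sum (fun _ _ => Nat.zero_le _)
      (Finset.mem_univ j)) h2
  have htop : ⨆ μ, Module.End.maxGenEigenspace (D : Module.End ℝ V) μ = ⊤ := by
    rw [hDcoe]; exact H.iSup_maxGenEigenspace_average_eq_top _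
  choose π hker hπ using fun k : Fin n =>
    exists_projection_forall_norm_le htop (k * ((1 - χ) / m))
  -- `Θ` collects the expanding parts of all `e j ^ k y`. Its injectivity is the linear algebra
  -- statement above, and finite dimension turns this into `‖y‖ ≤ κ * ‖Θ y‖`.
  let Θ : V₁ →ₗ[ℝ] (Fin m × Fin n → V) :=
    LinearMap.pi fun p => π p.2 ∘ₗ ((e p.1 ^ (p.2 : ℕ) : V →L[ℝ] V) : V →ₗ[ℝ] V) ∘ₗ V₁.subtype
  have hΘker : LinearMap.ker Θ = ⊥ := by
    rw [LinearMap.ker_eq_bot']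
    intro y hy
    refine Subtype.ext (H.eq_zero_of_forall_pow_mem hm hχ V₁ hV₁ hfix y.2 fun j k => ?_)
    rw [coe_pow_apply, ← hDcoe]
    rcases lt_or_ge k n with hk | hk
    · rw [← hker ⟨k, hk⟩]
      exact congrFun hy (j, ⟨k, hk⟩)
    · rw [pow_eq_zero_of_le hk (hn j)]
      exact zero_mem _
  obtain ⟨κ, hκ, hΘ⟩ := Θ.exists_antilipschitzWith hΘker
  obtain ⟨C, hC, hCcoeff⟩ := exists_norm_coeff_le V n
  have hκ' : (0 : ℝ) < κ := hκ
  have hev := eventually_all.2 fun k : Fin n =>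
    hπ k (ε / (κ * (n.factorial * C))) (by positivity)
  filter_upwards [hev] with s hs y hy M hM
  rcases Nat.eq_zero_or_pos m with rfl | hm0
  · omega
  have hM0 : 0 ≤ M := (norm_nonneg _).trans (hM ⟨0, hm0⟩ 0 (by simp))
  -- These are the coefficients of `σ ^ k`, up to `k!`. The `k`-th power of the push size is exactly
  -- the factor in the projection estimate at threshold `k (1 - χ) / m`.
  have hcoeff : ∀ j, ∀ k : Fin n, Real.exp (-(k * ((1 - χ) / m) * s)) *
      ‖NormedSpace.exp (s • D) ((e j ^ (k : ℕ)) y)‖ ≤ n.factorial * (C * M) := by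
    intro j k
    have h1 := hCcoeff (fun k => (Real.exp (-((1 - χ) / m * s)) ^ k * (k.factorial : ℝ)⁻¹) •
      NormedSpace.exp (s • D) ((e j ^ k) y)) M (fun σ hσ => ?_) k k.2
    · rw [norm_smul, Real.norm_of_nonneg (by positivity), ← Real.exp_nat_mul,
        show (k : ℕ) * -((1 - χ) / m * s) = -(k * ((1 - χ) / m) * s) by ring] at h1
      have hk : ((k : ℕ).factorial : ℝ) ≤ n.factorial := by
        exact_mod_cast Nat.factorial_le k.2.le
      have hk0 : (0 : ℝ) < (k : ℕ).factorial := by positivity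
      rw [mul_right_comm, ← div_eq_mul_inv, div_le_iff₀ hk0] at h1
      refine h1.trans ?_
      rw [mul_comm]
      exact mul_le_mul_of_nonneg_right hk (by positivity)
    · refine le_trans (le_of_eq ?_) (hM j σ hσ)
      rw [exp_smul_apply_of_pow_apply_eq_zero (e j) (n := n) (v := y) (by rw [hn]; rfl), map_sum]
      congr 1
      refine Finset.sum_congr rfl fun k _ => ?_
      rw [map_smul, smul_smul, mul_pow]
      congr 1
      ring
  have hΘy : ‖Θ ⟨y, hy⟩‖ ≤ ε / κ * M := by
    refine (pi_norm_le_iff_of_nonneg (by positivity)).2 fun p => ?_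
    refine (hs p.2 ((e p.1 ^ (p.2 : ℕ)) y)).trans ?_
    refine (mul_le_mul_of_nonneg_left (hcoeff p.1 p.2) (by positivity)).trans_eq ?_
    have : (n.factorial : ℝ) ≠ 0 := by positivity
    field_simp
  have h3 := hΘ.le_mul_dist ⟨y, hy⟩ 0
  rw [map_zero, dist_zero_right, dist_zero_right] at h3
  calc ‖y‖ ≤ κ * ‖Θ ⟨y, hy⟩‖ := h3
    _ ≤ κ * (ε / κ * M) := mul_le_mul_of_nonneg_left hΘy hκ'.le
    _ = ε * M := by field_simp

end Expansion

/-! ### The elements `u_v` and `a_t` in terms of elementary matrices -/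

section BlockMatrices

open Matrix.SpecialLinearGroup

theorem lowerBlock_last_last (m : ℕ) (A : Matrix (Fin m) (Fin m) ℝ) (v : Fin m → ℝ) (d : ℝ) :
    lowerBlock m A v d (Fin.last m) (Fin.last m) = d := by
  simp [lowerBlock]

theorem lowerBlock_castSucc_castSucc (m : ℕ) (A : Matrix (Fin m) (Fin m) ℝ) (v : Fin m → ℝ)
    (d : ℝ) (i j : Fin m) : lowerBlock m A v d i.castSucc j.castSucc = A i j := by
  change lowerBlock m A v d (Fin.castAdd 1 i) (Fin.castAdd 1 j) = A i j
  simp [lowerBlock]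

theorem lowerBlock_last_castSucc (m : ℕ) (A : Matrix (Fin m) (Fin m) ℝ) (v : Fin m → ℝ)
    (d : ℝ) (j : Fin m) : lowerBlock m A v d (Fin.last m) j.castSucc = v j := by
  change lowerBlock m A v d (Fin.last m) (Fin.castAdd 1 j) = v j
  simp [lowerBlock]

theorem lowerBlock_castSucc_last (m : ℕ) (A : Matrix (Fin m) (Fin m) ℝ) (v : Fin m → ℝ)
    (d : ℝ) (i : Fin m) : lowerBlock m A v d i.castSucc (Fin.last m) = 0 := by
  change lowerBlock m A v d (Fin.castAdd 1 i) (Fin.last m) = 0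
  simp [lowerBlock]

theorem uElt_add (m : ℕ) (v w : EuclideanSpace ℝ (Fin m)) :
    uElt m (v + w) = uElt m v * uElt m w := by
  apply Subtype.ext
  change lowerBlock m 1 _ 1 = lowerBlock m 1 _ 1 * lowerBlock m 1 _ 1
  simp only [lowerBlock, reindex_apply, submatrix_mul_equiv, fromBlocks_multiply]
  congr 2
  · simp
  · simp
  · ext i j; simp [mul_apply]
  · ext i j; simp [mul_apply]

theorem uElt_single (m : ℕ) (j : Fin m) (x : ℝ) :
    uElt m (EuclideanSpace.single j x) = transvection (Fin.castSucc_ne_last j).symm x := by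
  apply Subtype.ext
  rw [transvection_coe]
  ext p q
  change lowerBlock m 1 _ 1 p q = _
  induction p using Fin.lastCases <;> induction q using Fin.lastCases <;>
    simp [lowerBlock_last_last, lowerBlock_castSucc_castSucc, lowerBlock_last_castSucc,
      lowerBlock_castSucc_last, one_apply, single_apply, eq_comm]

theorem continuous_uElt (m : ℕ) : Continuous (uElt m) := by
  refine continuous_induced_rng.2 (continuous_matrix fun p q => ?_)
  change Continuous fun v : EuclideanSpace ℝ (Fin m) => lowerBlock m 1 (fun j => v j) 1 p q
  induction p using Fin.lastCases <;> induction q using Fin.lastCases <;>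
    simp only [lowerBlock_last_last, lowerBlock_castSucc_castSucc, lowerBlock_last_castSucc,
      lowerBlock_castSucc_last] <;> fun_prop

theorem aElt_coe_eq_diagonal (m : ℕ) (hm : 1 ≤ m) (t : ℝ) (ht : 0 < t) :
    (aElt m hm t ht).1 =
      diagonal fun k => if k = Fin.last m then t else t ^ (-(1 : ℝ) / m) := by
  ext p q
  change lowerBlock m _ _ _ p q = _
  induction p using Fin.lastCases <;> induction q using Fin.lastCases <;>
    simp [lowerBlock_last_last, lowerBlock_castSucc_castSucc, lowerBlock_last_castSucc,
      lowerBlock_castSucc_last, one_apply, diagonal_apply, eq_comm]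

/-- With `u = -log t / m`, the product has last entry `exp (m u) = t⁻¹` and other entries `exp (-u)
= t ^ (1 / m)`. -/
theorem aElt_inv_coe (m : ℕ) (hm : 1 ≤ m) (t : ℝ) (ht : 0 < t)
    {g : SpecialLinearGroup (Fin (m + 1)) ℝ}
    (hg : g.1 = diagonal (∏ i : Fin m, fun k =>
      if k = Fin.last m then Real.exp (-Real.log t * (m : ℝ)⁻¹)
      else if k = i.castSucc then (Real.exp (-Real.log t * (m : ℝ)⁻¹))⁻¹ else 1)) :
    g = (aElt m hm t ht)⁻¹ := by
  refine eq_inv_of_mul_eq_one_left (Subtype.ext ?_)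
  have hm' : (m : ℝ) ≠ 0 := by positivity
  change g.1 * (aElt m hm t ht).1 = 1
  rw [hg, aElt_coe_eq_diagonal, diagonal_mul_diagonal, ← diagonal_one]
  congr 1
  ext k
  rw [Finset.prod_apply]
  induction k using Fin.lastCases with
  | last =>
    simp only [if_true, Finset.prod_const, Finset.card_univ, Fintype.card_fin]
    rw [← Real.exp_nat_mul, mul_left_comm, mul_inv_cancel₀ hm', mul_one, Real.exp_neg,
      Real.exp_log ht, inv_mul_cancel₀ ht.ne']
  | cast j =>
    simp only [Fin.castSucc_ne_last, if_false, Fin.castSucc_inj]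
    rw [Finset.prod_ite_eq Finset.univ j]
    simp only [Finset.mem_univ, if_true]
    rw [← Real.exp_neg, Real.rpow_def_of_pos ht, ← Real.exp_add, Real.exp_eq_one_iff]
    ring

end BlockMatrices

/-! ### Differentiating the representation -/

section Differential

open Matrix.SpecialLinearGroup Filter Topology

variable {m : ℕ} {V : Type*} [NormedAddCommGroup V] [NormedSpace ℝ V] [FiniteDimensional ℝ V]

/-- The differential of a continuous representation of `SL (m + 1)`, evaluated on the root vectors
and coroots of the last row and column. -/
theorem exists_isSlFamily (R : SpecialLinearGroup (Fin (m + 1)) ℝ →* (V →L[ℝ] V))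
    (hR : Continuous R) :
    ∃ e f h : Fin m → V →L[ℝ] V,
      IsSlFamily (fun i => (e i : Module.End ℝ V)) (fun i => (f i : Module.End ℝ V))
        (fun i => (h i : Module.End ℝ V)) ∧
      (∀ i x, R (transvection (Fin.castSucc_ne_last i).symm x) = NormedSpace.exp (x • e i)) ∧
      (∀ i x, R (transvection (Fin.castSucc_ne_last i) x) = NormedSpace.exp (x • f i)) ∧
      (∀ i s, R (diag2n (Fin.castSucc_ne_last i).symm (Real.exp s) (Real.exp_ne_zero s)) =
        NormedSpace.exp (s • h i)) := by
  have htr : ∀ (i j : Fin (m + 1)) (hij : i ≠ j), ∃ a : V →L[ℝ] V, ∀ x,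
      R (transvection hij x) = NormedSpace.exp (x • a) := fun i j hij =>
    exists_eq_exp_smul_of_continuous (hR.comp (continuous_transvection hij))
      (by simp) (fun s t => by simp [transvection_add])
  have hdiag : ∀ (i j : Fin (m + 1)) (hij : i ≠ j), ∃ a : V →L[ℝ] V, ∀ s,
      R (diag2n hij (Real.exp s) (Real.exp_ne_zero s)) = NormedSpace.exp (s • a) := by
    intro i j hij
    refine exists_eq_exp_smul_of_continuous (hR.comp (continuous_diag2n_exp hij)) ?_ ?_
    · have : diag2n hij (Real.exp 0) (Real.exp_ne_zero 0) = 1 := by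
        apply Subtype.ext
        rw [diag2n_eq_one_add_single]
        simp
      rw [Function.comp_apply, this, map_one]
    · intro s t
      simp only [Function.comp_apply]
      rw [← map_mul, diag2n_mul_diag2n]
      simp only [Real.exp_add]
  choose e he using fun i : Fin m => htr _ _ (Fin.castSucc_ne_last i).symm
  choose f hf using fun i : Fin m => htr _ _ (Fin.castSucc_ne_last i)
  choose h hh using fun i : Fin m => hdiag _ _ (Fin.castSucc_ne_last i).symm
  refine ⟨e, f, h, ⟨?_, ?_, ?_, ?_⟩, he, hf, hh⟩
  · intro i j
    have := lie_eq_smul_of_exp_conj (h := h i) (e := h j) (c := 0) fun s x => by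
      rw [← hh, ← hh, zero_mul, Real.exp_zero, mul_one, ← hh, ← map_mul, ← map_mul,
        (diag2n_commute _ _ _ _).eq]
    rw [zero_smul, add_zero] at this
    exact congrArg ContinuousLinearMap.toLinearMap this
  · intro i
    have := lie_eq_of_exp_mul_exp (e := e i) (f := f i) (h := h i) fun x y hxy => by
      rw [← he, ← hf, ← hh, ← he, ← hf, ← map_mul, ← map_mul, ← map_mul,
        transvection_mul_transvection_swap _ hxy.ne']
      simp only [Real.exp_log hxy]
    exact congrArg ContinuousLinearMap.toLinearMap this
  · intro i j
    have := lie_eq_smul_of_exp_conj (h := h i) (e := e j) (c := if i = j then 2 else 1)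
      fun s x => by
        rw [← hh, ← he, ← he, ← map_mul, ← map_mul, diag2n_mul_transvection]
        congr 3
        by_cases hij : i = j
        · subst hij
          simp [two_mul, Real.exp_add, Fin.castSucc_ne_last]
          ring
        · simp [hij, Ne.symm hij, Fin.castSucc_ne_last, mul_comm]
    exact congrArg ContinuousLinearMap.toLinearMap this
  · intro i
    have := lie_eq_smul_of_exp_conj (h := h i) (e := f i) (c := -2)
      fun s x => by
        rw [← hh, ← hf, ← hf, ← map_mul, ← map_mul, diag2n_mul_transvection]
        congr 3
        simp [two_mul, Real.exp_add, Real.exp_neg, Fin.castSucc_ne_last]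
        ring
    exact congrArg ContinuousLinearMap.toLinearMap this

theorem map_aElt_inv (hm : 1 ≤ m) (R : SpecialLinearGroup (Fin (m + 1)) ℝ →* (V →L[ℝ] V))
    {h : Fin m → V →L[ℝ] V} (hc : ∀ i j, Commute (h i) (h j))
    (hh : ∀ i s, R (diag2n (Fin.castSucc_ne_last i).symm (Real.exp s) (Real.exp_ne_zero s)) =
        NormedSpace.exp (s • h i)) (t : ℝ) (ht : 0 < t) :
    R (aElt m hm t ht)⁻¹ = NormedSpace.exp ((-Real.log t) • (m : ℝ)⁻¹ • ∑ i, h i) := by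
  -- The group element is built one coroot at a time, its matrix and its image being tracked
  -- together.
  have key : ∀ (u : ℝ) (S : Finset (Fin m)), ∃ g : SpecialLinearGroup (Fin (m + 1)) ℝ,
      R g = NormedSpace.exp (u • ∑ i ∈ S, h i) ∧
      g.1 = diagonal (∏ i ∈ S, fun k => if k = Fin.last m then Real.exp u
        else if k = i.castSucc then (Real.exp u)⁻¹ else 1) := by
    intro u S
    induction S using Finset.induction_on with
    | empty => exact ⟨1, by simp, by simp⟩
    | insert a S ha ih =>
      obtain ⟨g, hg1, hg2⟩ := ih
      let _ : NormedAlgebra ℚ (V →L[ℝ] V) := NormedAlgebra.restrictScalars ℚ ℝ _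
      refine ⟨diag2n (Fin.castSucc_ne_last a).symm (Real.exp u) (Real.exp_ne_zero u) * g, ?_, ?_⟩
      · rw [map_mul, hh, hg1, Finset.sum_insert ha, smul_add, NormedSpace.exp_add_of_commute]
        exact ((Commute.sum_right _ _ _ fun i _ => hc a i).smul_left u).smul_right u
      · change (diag2n _ _ _).1 * g.1 = _
        rw [hg2, diag2n_coe, diagonal_mul_diagonal, Finset.prod_insert ha]
        rfl
  obtain ⟨g, hg1, hg2⟩ := key (-Real.log t * (m : ℝ)⁻¹) Finset.univ
  rw [← aElt_inv_coe m hm t ht hg2, hg1, smul_smul]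

theorem apply_mem_of_exp_smul_apply_mem {a : V →L[ℝ] V} {W : Submodule ℝ V} {x : V}
    (hx : ∀ s : ℝ, NormedSpace.exp (s • a) x ∈ W) : a x ∈ W := by
  have h1 : HasDerivAt (fun s : ℝ => NormedSpace.exp (s • a) x) (a x) 0 := by
    have := (hasDerivAt_exp_smul_const a (0 : ℝ)).clm_apply (hasDerivAt_const (0 : ℝ) x)
    simpa using this
  refine (Submodule.closed_of_finiteDimensional W).mem_of_tendsto h1.tendsto_slope_zero
    (Eventually.of_forall fun t => ?_)
  exact W.smul_mem _ (W.sub_mem (hx _) (hx _))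

end Differential

/-! ### The expansion theorem -/

theorem mainTheorem8 (m : ℕ) (hm : 1 ≤ m)
    {V : Type*} [NormedAddCommGroup V] [NormedSpace ℝ V] [FiniteDimensional ℝ V]
    (ρ : Representation ℝ (SpecialLinearGroup (Fin (m + 1)) ℝ) V)
    (hρ : ∀ x : V, Continuous fun g : SpecialLinearGroup (Fin (m + 1)) ℝ => ρ g x)
    (V₁ : Submodule ℝ V) (hV₁ : ∀ g : SpecialLinearGroup (Fin (m + 1)) ℝ, ∀ x ∈ V₁, ρ g x ∈ V₁)
    (hcompl : IsCompl V₁ ρ.invariants)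
    (r : ℝ) (hr : 0 < r)
    (g₀ : SpecialLinearGroup (Fin (m + 1)) ℝ)
    (K : Set (EuclideanSpace ℝ (Fin m))) (hK : Bornology.IsBounded K)
    (χ : ℝ) (hχ : χ ∈ Set.Ioo (0 : ℝ) 1) :
    ∀ ν : ℝ, 0 < ν → ∃ t₀ : ℝ, 0 < t₀ ∧
      ∀ (t : ℝ) (ht : 0 < t), t < t₀ → ∀ ξ ∈ K, ∀ x : V,
        r ≤ ‖Submodule.projection V₁ ρ.invariants hcompl x‖ →
          ENNReal.ofReal ν <
            ⨆ v ∈ Metric.ball ξ (t ^ ((1 - χ) / (m : ℝ))),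
              ‖ρ ((aElt m hm t ht)⁻¹ * (uElt m v)⁻¹ * g₀) x‖ₑ := by
  intro ν hν
  let R : SpecialLinearGroup (Fin (m + 1)) ℝ →* (V →L[ℝ] V) :=
    { toFun := fun g => LinearMap.toContinuousLinearMap (ρ g)
      map_one' := by ext v; simp
      map_mul' := fun g g' => by ext v; simp }
  have hRρ : ∀ g v, R g v = ρ g v := fun g v => rfl
  have hR : Continuous R := continuous_clm_apply.2 hρ
  obtain ⟨e, f, h, H, he, hf, hh⟩ := exists_isSlFamily R hR
  -- A vector killed by all `e i` and `f i` is fixed by transvections generating the group, so it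
  -- lies in `V₁ ∩ ρ.invariants = 0`.
  have hfix : ∀ x ∈ V₁, (∀ i, e i x = 0) → (∀ i, f i x = 0) → x = 0 := by
    intro x hx hex hfx
    have hexp : ∀ a : V →L[ℝ] V, a x = 0 → ∀ s : ℝ, NormedSpace.exp (s • a) x = x := by
      intro a ha s
      rw [exp_smul_apply_of_pow_apply_eq_zero a (n := 1) (by simpa using ha)]
      simp
    let S : Subgroup (SpecialLinearGroup (Fin (m + 1)) ℝ) :=
      { carrier := {g | ρ g x = x}
        one_mem' := by simp
        mul_mem' := fun {g g'} hg hg' => by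
          change ρ g x = x at hg
          change ρ g' x = x at hg'
          change ρ (g * g') x = x
          rw [map_mul, Module.End.mul_apply, hg', hg]
        inv_mem' := fun {g} hg => by
          change ρ g x = x at hg
          change ρ g⁻¹ x = x
          nth_rewrite 1 [← hg]
          rw [Representation.inv_self_apply] }
    have : Nontrivial (Fin (m + 1)) := Fin.nontrivial_iff_two_le.2 (by omega)
    have hS : S = ⊤ := by
      refine eq_top_of_transvection_mem S (Fin.last m) (fun j hj s => ?_) fun j hj s => ?_
      · obtain ⟨i, rfl⟩ := Fin.exists_castSucc_eq.2 hj.symm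
        change R _ x = x
        rw [he]
        exact hexp _ (hex i) s
      · obtain ⟨i, rfl⟩ := Fin.exists_castSucc_eq.2 hj
        change R _ x = x
        rw [hf]
        exact hexp _ (hfx i) s
    refine Submodule.disjoint_def.1 hcompl.disjoint x hx ((Representation.mem_invariants ρ x).2
      fun g => ?_)
    exact (hS ▸ Subgroup.mem_top g : g ∈ S)
  have hV₁h : ∀ i, ∀ x ∈ V₁, h i x ∈ V₁ := fun i x hx =>
    apply_mem_of_exp_smul_apply_mem fun s => by rw [← hh]; exact hV₁ _ x hx
  -- Compactness of the closure of `K` makes the passage from `y` back to `Q x` uniform in `ξ`.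
  obtain ⟨B, hB⟩ := hK.isCompact_closure.exists_bound_of_continuousOn
    (f := fun ξ => R (g₀⁻¹ * uElt m ξ))
    (hR.comp (continuous_const.mul (continuous_uElt m))).continuousOn
  set B' : ℝ := max B 1 with hB'
  have hB0 : 0 < B' := lt_max_of_lt_right one_pos
  set Q : V →ₗ[ℝ] V := Submodule.projection V₁ ρ.invariants hcompl with hQ
  set C : ℝ := ‖LinearMap.toContinuousLinearMap Q‖ + 1 with hC
  have hC0 : 0 < C := by positivity
  have hQC : ∀ v, ‖Q v‖ ≤ C * ‖v‖ := fun v =>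
    ((LinearMap.toContinuousLinearMap Q).le_opNorm v).trans
      (mul_le_mul_of_nonneg_right (by linarith) (norm_nonneg v))
  have hQρ : ∀ g v, Q (ρ g v) = ρ g (Q v) := by
    intro g v
    have h1 : v - Q v ∈ ρ.invariants := Submodule.sub_projection_mem hcompl v
    have h2 : ρ g v = ρ g (Q v) + (v - Q v) := by
      conv_rhs => rw [← (Representation.mem_invariants ρ _).1 h1 g, ← map_add, add_sub_cancel]
    rw [h2, map_add, (Submodule.projection_apply_eq_zero_iff hcompl).2 h1, add_zero,
      Submodule.projection_apply_of_mem_left hcompl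
        (hV₁ g _ (Submodule.projection_apply_mem hcompl v))]
  -- Chosen so that the final bound is `‖Q x‖ ≤ r / 2`.
  have hε : 0 < r / (2 * (B' * (C * ν))) := by positivity
  obtain ⟨s₀, hs₀⟩ := Filter.eventually_atTop.1
    (IsSlFamily.eventually_norm_le hm H hχ.1 V₁ hV₁h hfix hε)
  refine ⟨Real.exp (-s₀), Real.exp_pos _, fun t ht htt ξ hξ x hx => ?_⟩
  by_contra! hsup
  have hbound : ∀ v ∈ Metric.ball ξ (t ^ ((1 - χ) / (m : ℝ))),
      ‖ρ ((aElt m hm t ht)⁻¹ * (uElt m v)⁻¹ * g₀) x‖ ≤ ν := by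
    intro v hv
    have h1 := (iSup₂_le_iff.1 hsup) v hv
    rwa [← ofReal_norm, ENNReal.ofReal_le_ofReal_iff hν.le] at h1
  have hs : s₀ ≤ -Real.log t := by
    have := (Real.log_lt_iff_lt_exp ht).2 htt
    linarith
  set y : V := ρ ((uElt m ξ)⁻¹ * g₀) (Q x) with hy
  have hyV : y ∈ V₁ := hV₁ _ _ (Submodule.projection_apply_mem hcompl x)
  have hβ : Real.exp (-((1 - χ) / m * -Real.log t)) = t ^ ((1 - χ) / (m : ℝ)) := by
    rw [Real.rpow_def_of_pos ht]
    congr 1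
    ring
  have hcomm : ∀ i j, Commute (h i) (h j) := fun i j => by
    ext v
    exact congrArg (fun T : Module.End ℝ V => T v) (H.comm_h i j)
  have hyle := hs₀ _ hs y hyV (C * ν) fun j σ hσ => by
    rw [hβ]
    set β := t ^ ((1 - χ) / (m : ℝ)) with hβ'
    have hβ0 : 0 < β := Real.rpow_pos_of_pos ht _
    -- The sign cancels the inverse on `u_v`, and additivity of `u` splits off the factor `u_ξ⁻¹`
    -- absorbed in `y`.
    have hv : ξ + EuclideanSpace.single j (-(β * σ)) ∈ Metric.ball ξ β := by
      rw [mem_ball_iff_norm, add_sub_cancel_left, PiLp.norm_single, norm_neg, norm_mul,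
        Real.norm_eq_abs, Real.norm_eq_abs, abs_of_pos hβ0]
      exact mul_lt_of_lt_one_right hβ0 hσ
    have h1 := hbound _ hv
    rw [uElt_add, uElt_single, _root_.mul_inv_rev, SpecialLinearGroup.transvection_inv, neg_neg] at h1
    rw [← map_aElt_inv hm R hcomm hh t ht, ← he, hRρ, hRρ, hy, ← Module.End.mul_apply,
      ← Module.End.mul_apply, ← map_mul, ← map_mul, ← hQρ]
    simp only [mul_assoc] at h1 ⊢
    exact (hQC _).trans (mul_le_mul_of_nonneg_left h1 hC0.le)
  have hxy : Q x = R (g₀⁻¹ * uElt m ξ) y := by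
    rw [hRρ, hy, ← Module.End.mul_apply, ← map_mul]
    rw [show g₀⁻¹ * uElt m ξ * ((uElt m ξ)⁻¹ * g₀) = 1 by group, map_one, Module.End.one_apply]
  have hfinal : ‖Q x‖ ≤ B' * (r / (2 * (B' * (C * ν))) * (C * ν)) := by
    rw [hxy]
    refine (ContinuousLinearMap.le_of_opNorm_le _
      ((hB ξ (subset_closure hξ)).trans (le_max_left B 1)) y).trans ?_
    exact mul_le_mul_of_nonneg_left hyle hB0.le
  have hhalf : B' * (r / (2 * (B' * (C * ν))) * (C * ν)) = r / 2 := by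
    field_simp
  linarith
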